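/- For every $p\in(1,\infty)$ there is an integer $N=N(p)\ge 1$ such that the following holds for every dimension $d\ge 1$. Let $s\in(0,1]$ and let $f:\mathbb{R}^d\to[0,\infty)$ be a probability density with $f\in L^1(\mathbb{R}^d)\cap L^p(\mathbb{R}^d)$ and $$\int_{\mathbb{R}^d} x f(x)\,dx=0,\qquad \int_{\mathbb{R}^d} x_ix_j f(x)\,dx=\delta_{ij},\qquad \int_{\mathbb{R}^d}|x|^{2+s}f(x)\,dx=:\rho_{2+s}<\infty .$$ Let $(\sigma_i)_{i\ge1}$ be a sequence of positive numbers, write $f_\sigma(x):=\sigma^{-d}f(x/\sigma)$, and for $n\ge1$ define $$f^{\sigma_1,\dots,\sigma_n}:=f_{\sigma_1}*\cdots*f_{\sigma_n},\qquad \bar\sigma^2:=\frac1n\sum_{i=1}^n\sigma_i^2\ \ (\bar\sigma>0),\qquad \mathfrak{f}_n(x):=(\bar\sigma^2n)^{d/2}\,f^{\sigma_1,\dots,\sigma_n}(\sqrt n\,\bar\sigma x).$$ Let $l,L>0$. Then there is a constant $C_{BE}>0$, depending only on $L/l$, $p$, $d$, $\rho_{2+s}$ and $\|f\|_{L^p}$,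 such that for every $n\ge N$ for which $l\le\sigma_i\le L$ for $i=1,\dots,n$, we have $\mathfrak{f}_n\in L^\infty(\mathbb{R}^d)$ and $$\|\mathfrak{f}_n-G\|_{L^\infty}\le\frac{C_{BE}}{n^{s/2}},$$ where $G(x)=(2\pi)^{-d/2}e^{-|x|^2/2}$ is the standard Gaussian density on $\mathbb{R}^d$. -/

import Mathlib

open MeasureTheory
open scoped ENNReal NNReal Convolution

noncomputable section

namespace BerryEsseen

/-- `f : ℝᵈ → [0, ∞)` is a probability density which is centred, has identity covariance matrix
and a finite moment of order `2 + s`, equal to `ρ`. -/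
structure IsNormalisedDensity {d : ℕ} (f : EuclideanSpace ℝ (Fin d) → ℝ) (s ρ : ℝ) : Prop where
  nonneg : ∀ x, 0 ≤ f x
  integrable : Integrable f
  integral_eq_one : ∫ x, f x = 1
  mean : ∫ x, f x • x = 0
  covariance : ∀ i j : Fin d, ∫ x, x i * x j * f x = if i = j then 1 else 0
  integrable_moment : Integrable fun x => ‖x‖ ^ (2 + s) * f x
  moment : ∫ x, ‖x‖ ^ (2 + s) * f x = ρ

/-- The mass-preserving rescaling `f_σ(x) = σ⁻ᵈ f(x / σ)`. -/
def rescale {d : ℕ} (f : EuclideanSpace ℝ (Fin d) → ℝ) (σ : ℝ) :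
    EuclideanSpace ℝ (Fin d) → ℝ :=
  fun x => (σ ^ d)⁻¹ * f (σ⁻¹ • x)

/-- The convolution `f_{σ₁} * ⋯ * f_{σₙ}`, for `n ≥ 1`. The value at `n = 0` is a placeholder. -/
def convRescale {d : ℕ} (f : EuclideanSpace ℝ (Fin d) → ℝ) (σ : ℕ → ℝ) :
    ℕ → EuclideanSpace ℝ (Fin d) → ℝ
  | 0 => 0
  | 1 => rescale f (σ 1)
  | n + 2 => convRescale f σ (n + 1) ⋆[ContinuousLinearMap.mul ℝ ℝ, volume] rescale f (σ (n + 2))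

/-- The quadratic mean `σ̄` of `σ₁, …, σₙ`: `σ̄² = (σ₁² + ⋯ + σₙ²) / n`. -/
def quadMean (σ : ℕ → ℝ) (n : ℕ) : ℝ :=
  Real.sqrt ((∑ i ∈ Finset.Icc 1 n, σ i ^ 2) / n)

/-- The normalised density `𝔣ₙ(x) = (σ̄² n)^{d/2} (f_{σ₁} * ⋯ * f_{σₙ})(√n σ̄ x)`. -/
def normalisedDensity {d : ℕ} (f : EuclideanSpace ℝ (Fin d) → ℝ) (σ : ℕ → ℝ) (n : ℕ) :
    EuclideanSpace ℝ (Fin d) → ℝ :=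
  fun x => (quadMean σ n ^ 2 * n) ^ ((d : ℝ) / 2) *
    convRescale f σ n ((Real.sqrt n * quadMean σ n) • x)

/-- The density of the standard Gaussian on `ℝᵈ`. -/
def gaussian (d : ℕ) : EuclideanSpace ℝ (Fin d) → ℝ :=
  fun x => (2 * Real.pi) ^ (-((d : ℝ) / 2)) * Real.exp (-‖x‖ ^ 2 / 2)

end BerryEsseen

end

namespace BerryEsseen

open scoped RealInnerProductSpace FourierTransform

variable {d : ℕ}

/-! With `φ = charFn f` and `a i = σ i / (√n σ̄)`, the characteristic function of `𝔣ₙ` is `∏ φ (a i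
• t)`, where `∑ a i ^ 2 = 1` and every `a i` is comparable to `1/√n` up to the factor `Λ = L / l`.
Fourier inversion bounds the sup distance to the Gaussian by the `L¹` distance of the characteristic
functions, so it suffices that `∏ φ (a i • t) - exp (-‖t‖² / 2)` has `L¹` norm `O(n^(-s/2))`.

Three facts about `φ` give this, each with constants depending only on `d`, `p`, `ρ` and `‖f‖_p`.
(1) Some power `‖φ‖ ^ N` is integrable, with `N` depending only on `p`
(`integrable_and_integral_norm_charFn_pow_le`). Cutting `f` at a level `λ` leaves a bounded part,
controlled by Plancherel, and a part of small mass; optimising `λ` bounds the level sets of `φ`. (2)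
`‖φ u‖ ≤ exp (-c min(1, ‖u‖²))` (`exists_norm_charFn_le_exp`). If `‖φ u‖` were near `1`, the mass of
`f` would sit on thin slabs where `⟪x, u⟫` is nearly constant modulo `2π`, but the `L^p` bound and
the second moment forbid this. Doubling carries the gap towards the origin. (3) Near the origin, `φ`
agrees with the Gaussian up to `O(‖u‖^(2+s))`, by Taylor expansion and the moment conditions.

Where all arguments `a i • t` lie in the unit ball, telescoping the product with (2) and (3) gives
the rate. Elsewhere all arguments stay away from `0`: `N` factors give integrability by (1), and the
other `n - N` give exponential decay in `n` by (2). -/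

/-- The characteristic function of the (signed) measure with density `f`. -/
noncomputable def charFn (f : EuclideanSpace ℝ (Fin d) → ℝ) (t : EuclideanSpace ℝ (Fin d)) : ℂ :=
  ∫ x, Complex.exp (⟪x, t⟫ * Complex.I) * f x

/-! ### Characteristic functions under convolution and rescaling. -/

theorem norm_cexp_inner_mul_I (x t : EuclideanSpace ℝ (Fin d)) :
    ‖Complex.exp (⟪x, t⟫ * Complex.I)‖ = 1 :=
  Complex.norm_exp_ofReal_mul_I _

theorem integrable_cexp_inner_mul {g : EuclideanSpace ℝ (Fin d) → ℂ} (hg : Integrable g)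
    (t : EuclideanSpace ℝ (Fin d)) :
    Integrable fun x => Complex.exp (⟪x, t⟫ * Complex.I) * g x := by
  refine hg.bdd_mul (c := 1) ?_ ?_
  · exact Continuous.aestronglyMeasurable (by fun_prop)
  · exact Filter.Eventually.of_forall fun x => (norm_cexp_inner_mul_I x t).le

theorem integrable_cexp_inner_mul_ofReal {f : EuclideanSpace ℝ (Fin d) → ℝ} (hf : Integrable f)
    (t : EuclideanSpace ℝ (Fin d)) :
    Integrable fun x => Complex.exp (⟪x, t⟫ * Complex.I) * (f x : ℂ) :=
  integrable_cexp_inner_mul hf.ofReal t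

theorem norm_charFn_le (f : EuclideanSpace ℝ (Fin d) → ℝ) (t : EuclideanSpace ℝ (Fin d)) :
    ‖charFn f t‖ ≤ ∫ x, ‖f x‖ := by
  refine (norm_integral_le_integral_norm _).trans_eq ?_
  simp

theorem continuous_charFn {f : EuclideanSpace ℝ (Fin d) → ℝ} (hf : Integrable f) :
    Continuous (charFn f) := by
  refine continuous_of_dominated (bound := fun x => ‖f x‖) ?_ ?_ hf.norm ?_
  · exact fun t => (integrable_cexp_inner_mul_ofReal hf t).aestronglyMeasurable
  · exact fun t => Filter.Eventually.of_forall fun x => by simp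
  · exact Filter.Eventually.of_forall fun x => by fun_prop

theorem fourier_ofReal (f : EuclideanSpace ℝ (Fin d) → ℝ) (w : EuclideanSpace ℝ (Fin d)) :
    𝓕 (fun x => (f x : ℂ)) w = charFn f (-(2 * Real.pi) • w) := by
  rw [Real.fourier_eq', charFn]
  refine integral_congr_ae (Filter.Eventually.of_forall fun x => ?_)
  simp [inner_smul_right]

theorem charFn_eq_fourier (f : EuclideanSpace ℝ (Fin d) → ℝ) (t : EuclideanSpace ℝ (Fin d)) :
    charFn f t = 𝓕 (fun x => (f x : ℂ)) (-(2 * Real.pi)⁻¹ • t) := by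
  rw [fourier_ofReal, smul_smul]
  congr
  have := Real.pi_ne_zero
  field_simp
  simp

theorem charFn_sub {f g : EuclideanSpace ℝ (Fin d) → ℝ} (hf : Integrable f) (hg : Integrable g)
    (t : EuclideanSpace ℝ (Fin d)) :
    charFn (fun x => f x - g x) t = charFn f t - charFn g t := by
  simp only [charFn]
  rw [← integral_sub (integrable_cexp_inner_mul_ofReal hf t)
    (integrable_cexp_inner_mul_ofReal hg t)]
  simp [mul_sub]

theorem ofReal_convolution (f g : EuclideanSpace ℝ (Fin d) → ℝ) (x : EuclideanSpace ℝ (Fin d)) :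
    (((f ⋆[ContinuousLinearMap.mul ℝ ℝ, volume] g) x : ℝ) : ℂ) =
      ((fun x => (f x : ℂ)) ⋆[ContinuousLinearMap.mul ℂ ℂ, volume] fun x => (g x : ℂ)) x := by
  simp only [convolution, ContinuousLinearMap.mul_apply']
  refine (integral_ofReal (𝕜 := ℂ)).symm.trans ?_
  simp

theorem charFn_convolution {f g : EuclideanSpace ℝ (Fin d) → ℝ} (hf : Integrable f)
    (hg : Integrable g) (t : EuclideanSpace ℝ (Fin d)) :
    charFn (f ⋆[ContinuousLinearMap.mul ℝ ℝ, volume] g) t = charFn f t * charFn g t := by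
  simp only [charFn_eq_fourier, ofReal_convolution]
  exact Real.fourier_mul_convolution_eq hf.ofReal hg.ofReal _

theorem charFn_const_mul_comp_smul (f : EuclideanSpace ℝ (Fin d) → ℝ) {r : ℝ} (hr : 0 < r)
    (t : EuclideanSpace ℝ (Fin d)) :
    charFn (fun x => r ^ d * f (r • x)) t = charFn f (r⁻¹ • t) := by
  have h := Measure.integral_comp_smul_of_nonneg (μ := volume)
    (fun x => ((r ^ d : ℝ) : ℂ) * (Complex.exp (⟪x, r⁻¹ • t⟫ * Complex.I) * f x)) r (hR := hr.le)
  rw [finrank_euclideanSpace_fin] at h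
  rw [charFn, charFn]
  calc _ = _ := ?_
    _ = _ := h
    _ = _ := ?_
  · refine integral_congr_ae (Filter.Eventually.of_forall fun x => ?_)
    have : ⟪r • x, r⁻¹ • t⟫ = ⟪x, t⟫ := by
      rw [inner_smul_left, inner_smul_right]
      simp [hr.ne']
    simp only [this]
    push_cast
    ring
  · rw [integral_const_mul, Complex.real_smul, ← mul_assoc, ← Complex.ofReal_mul,
      inv_mul_cancel₀ (by positivity)]
    simp

theorem charFn_rescale (f : EuclideanSpace ℝ (Fin d) → ℝ) {σ : ℝ} (hσ : 0 < σ)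
    (t : EuclideanSpace ℝ (Fin d)) : charFn (rescale f σ) t = charFn f (σ • t) := by
  have := charFn_const_mul_comp_smul f (inv_pos.2 hσ) t
  rw [inv_inv] at this
  rw [← this]
  simp only [inv_pow]
  rfl

theorem integrable_rescale {f : EuclideanSpace ℝ (Fin d) → ℝ} (hf : Integrable f) {σ : ℝ}
    (hσ : 0 < σ) : Integrable (rescale f σ) :=
  (hf.comp_smul (inv_ne_zero hσ.ne')).const_mul _

theorem integrable_convRescale {f : EuclideanSpace ℝ (Fin d) → ℝ} (hf : Integrable f)
    {σ : ℕ → ℝ} (hσ : ∀ i, 1 ≤ i → 0 < σ i) : ∀ n, Integrable (convRescale f σ n)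
  | 0 => integrable_zero _ _ _
  | 1 => integrable_rescale hf (hσ 1 le_rfl)
  | n + 2 => (integrable_convRescale hf hσ (n + 1)).integrable_convolution _
      (integrable_rescale hf (hσ _ (by omega)))

theorem charFn_convRescale {f : EuclideanSpace ℝ (Fin d) → ℝ} (hf : Integrable f)
    {σ : ℕ → ℝ} (hσ : ∀ i, 1 ≤ i → 0 < σ i) (t : EuclideanSpace ℝ (Fin d)) :
    ∀ n, 1 ≤ n → charFn (convRescale f σ n) t = ∏ i ∈ Finset.Icc 1 n, charFn f (σ i • t)
  | 1, _ => by simp [convRescale, charFn_rescale f (hσ 1 le_rfl)]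
  | n + 2, _ => by
    rw [convRescale, charFn_convolution (integrable_convRescale hf hσ _)
      (integrable_rescale hf (hσ _ (by omega))), charFn_convRescale hf hσ t (n + 1) (by omega),
      charFn_rescale f (hσ _ (by omega)), Finset.prod_Icc_succ_top (by omega : 1 ≤ n + 1 + 1)]

/-! ### The Gaussian and its characteristic function. -/

theorem gaussian_nonneg (x : EuclideanSpace ℝ (Fin d)) : 0 ≤ gaussian d x := by
  unfold gaussian; positivity

theorem integrable_exp_neg_mul_sq_norm {b : ℝ} (hb : 0 < b) :
    Integrable fun x : EuclideanSpace ℝ (Fin d) => Real.exp (-b * ‖x‖ ^ 2) := by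
  have := (GaussianFourier.integrable_cexp_neg_mul_sq_norm_add (b := b)
    (by simpa using hb) 0 (0 : EuclideanSpace ℝ (Fin d))).norm
  refine this.congr (Filter.Eventually.of_forall fun x => ?_)
  simp only [Complex.norm_exp]
  congr 1
  simp [← Complex.ofReal_pow]

theorem integrable_gaussian : Integrable (gaussian d) := by
  have := (integrable_exp_neg_mul_sq_norm (d := d) (b := 1 / 2) (by norm_num)).const_mul
    ((2 * Real.pi) ^ (-((d : ℝ) / 2)))
  refine this.congr (Filter.Eventually.of_forall fun x => ?_)
  simp only [gaussian]
  congr 2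
  ring

theorem integral_cexp_inner_mul_exp_neg_mul_sq_norm {b : ℝ} (hb : 0 < b)
    (t : EuclideanSpace ℝ (Fin d)) :
    ∫ x : EuclideanSpace ℝ (Fin d), Complex.exp (⟪x, t⟫ * Complex.I) * (Real.exp (-b * ‖x‖ ^ 2) : ℝ) =
      (((Real.pi / b) ^ ((d : ℝ) / 2) * Real.exp (-‖t‖ ^ 2 / (4 * b)) : ℝ) : ℂ) := by
  have h := GaussianFourier.integral_cexp_neg_mul_sq_norm_add (b := b)
    (by simpa using hb) Complex.I t
  rw [finrank_euclideanSpace_fin] at h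
  calc _ = _ := ?_
    _ = _ := h
    _ = _ := ?_
  · refine integral_congr_ae (Filter.Eventually.of_forall fun x => ?_)
    simp only [Complex.ofReal_exp, ← Complex.exp_add]
    congr 1
    rw [real_inner_comm]
    push_cast
    ring
  · rw [Complex.ofReal_mul, Complex.ofReal_cpow (by positivity)]
    push_cast
    congr 2
    simp

theorem charFn_gaussian (t : EuclideanSpace ℝ (Fin d)) :
    charFn (gaussian d) t = (Real.exp (-‖t‖ ^ 2 / 2) : ℝ) := by
  have h := integral_cexp_inner_mul_exp_neg_mul_sq_norm (b := 1 / 2) (by norm_num) t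
  have h2 : charFn (gaussian d) t = ((2 * Real.pi) ^ (-((d : ℝ) / 2)) : ℝ) *
      ∫ x : EuclideanSpace ℝ (Fin d),
        Complex.exp (⟪x, t⟫ * Complex.I) * (Real.exp (-(1 / 2) * ‖x‖ ^ 2) : ℝ) := by
    rw [charFn, ← integral_const_mul]
    refine integral_congr_ae (Filter.Eventually.of_forall fun x => ?_)
    simp only [gaussian, Complex.ofReal_mul]
    rw [show -(1 / 2 : ℝ) * ‖x‖ ^ 2 = -‖x‖ ^ 2 / 2 by ring]
    ring
  rw [h2, h, ← Complex.ofReal_mul, ← mul_assoc]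
  congr 1
  rw [show Real.pi / (1 / 2) = 2 * Real.pi by ring, ← Real.rpow_add (by positivity)]
  norm_num

/-! ### Fourier inversion and the sup bound. -/

theorem integral_fourier_mul_eq {f g : EuclideanSpace ℝ (Fin d) → ℂ} (hf : Integrable f)
    (hg : Integrable g) : ∫ w, 𝓕 f w * g w = ∫ x, f x * 𝓕 g x := by
  simpa using! VectorFourier.integral_fourierIntegral_smul_eq_flip
    (L := innerₗ (EuclideanSpace ℝ (Fin d))) Real.continuous_fourierChar continuous_inner hf hg

theorem integral_fourierInv_mul_eq {f g : EuclideanSpace ℝ (Fin d) → ℂ} (hf : Integrable f)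
    (hg : Integrable g) : ∫ w, 𝓕⁻ f w * g w = ∫ x, f x * 𝓕⁻ g x := by
  have h := integral_fourier_mul_eq hf hg.comp_neg
  rw [← Real.fourierInv_eq_fourier_comp_neg] at h
  rw [← h, ← integral_neg_eq_self]
  simp only [Real.fourierInv_eq_fourier_neg, neg_neg]

open scoped ContDiff in
/-- A function with integrable Fourier transform agrees almost everywhere with the inverse
transform of its Fourier transform. -/
theorem ae_eq_fourierInv_fourier {f : EuclideanSpace ℝ (Fin d) → ℂ} (hf : Integrable f)
    (hf' : Integrable (𝓕 f)) : ∀ᵐ x, f x = 𝓕⁻ (𝓕 f) x := by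
  have hcont : Continuous (𝓕⁻ (𝓕 f)) :=
    VectorFourier.fourierIntegral_continuous Real.continuous_fourierChar
      (L := -innerₗ (EuclideanSpace ℝ (Fin d))) (by simpa using! continuous_inner.neg) hf'
  -- Both sides are tested against smooth compactly supported `g`. Such a `g` is Schwartz, hence `𝓕
  -- (𝓕⁻ g)`, and the multiplication formula moves the transforms between `f` and `g`; no continuity
  -- of `f` is needed.
  refine ae_eq_of_integral_contDiff_smul_eq hf.locallyIntegrable hcont.locallyIntegrable ?_
  intro g hg hg'
  have hG : ContDiff ℝ ∞ (fun x => (g x : ℂ)) := Complex.ofRealCLM.contDiff.comp hg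
  have hG' : HasCompactSupport (fun x => (g x : ℂ)) := hg'.comp_left Complex.ofReal_zero
  let G : SchwartzMap (EuclideanSpace ℝ (Fin d)) ℂ := hG'.toSchwartzMap hG
  have hGc : ∀ x, G x = (g x : ℂ) := fun x => rfl
  have hGi : Integrable (𝓕⁻ (G : EuclideanSpace ℝ (Fin d) → ℂ)) := by
    rw [← SchwartzMap.fourierInv_coe]
    exact (𝓕⁻ G).integrable
  have hGe : 𝓕 (𝓕⁻ (G : EuclideanSpace ℝ (Fin d) → ℂ)) = G := by
    refine G.continuous.fourier_fourierInv_eq G.integrable ?_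
    have : 𝓕 (G : EuclideanSpace ℝ (Fin d) → ℂ) = ((𝓕 G : SchwartzMap _ _) : _ → ℂ) :=
      (SchwartzMap.fourier_coe G).symm
    rw [this]
    exact (𝓕 G).integrable
  have h1 := integral_fourier_mul_eq hf hGi
  have h2 := integral_fourierInv_mul_eq hf' G.integrable
  rw [hGe] at h1
  simp only [Complex.real_smul, ← hGc, mul_comm (G _)]
  rw [h2, h1]

theorem norm_fourierInv_le (f : EuclideanSpace ℝ (Fin d) → ℂ) (x : EuclideanSpace ℝ (Fin d)) :
    ‖𝓕⁻ f x‖ ≤ ∫ w, ‖f w‖ :=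
  VectorFourier.norm_fourierIntegral_le_integral_norm _ _ _ _ _

/-- An integrable function is essentially bounded by the `L¹` norm of its characteristic
function. -/
theorem ae_abs_le_integral_norm_charFn {h : EuclideanSpace ℝ (Fin d) → ℝ} (hh : Integrable h)
    (hφ : Integrable (charFn h)) : ∀ᵐ x, |h x| ≤ ∫ t, ‖charFn h t‖ := by
  have hpi : (-(2 * Real.pi) : ℝ) ≠ 0 := by simp [Real.pi_ne_zero]
  have hF : 𝓕 (fun x => (h x : ℂ)) = fun w => charFn h (-(2 * Real.pi) • w) :=
    funext fun w => fourier_ofReal h w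
  have hFi : Integrable (𝓕 (fun x => (h x : ℂ))) := by
    rw [hF]; exact hφ.comp_smul hpi
  filter_upwards [ae_eq_fourierInv_fourier hh.ofReal hFi] with x hx
  have h1 : |h x| = ‖(h x : ℂ)‖ := by simp
  rw [h1]
  refine (congrArg norm hx).trans_le ((norm_fourierInv_le _ x).trans ?_)
  -- The substitution produces the factor `(2π)^(-d)`, which is at most `1` and is discarded.
  have h2 := Measure.integral_comp_smul (μ := volume) (fun t => ‖charFn h t‖) (-(2 * Real.pi))
  refine (congrArg (fun F => ∫ w, ‖F w‖) hF).trans_le ?_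
  simp only
  rw [h2, smul_eq_mul]
  refine mul_le_of_le_one_left (integral_nonneg fun _ => norm_nonneg _) ?_
  rw [abs_inv, abs_pow, abs_neg, abs_of_pos (by positivity)]
  exact inv_le_one_of_one_le₀ (one_le_pow₀ (by nlinarith [Real.pi_gt_three]))

/-! ### A Plancherel inequality for bounded densities. -/

theorem integral_charFn_mul_eq {g : EuclideanSpace ℝ (Fin d) → ℝ} (hg : Integrable g)
    {ψ : EuclideanSpace ℝ (Fin d) → ℂ} (hψ : Integrable ψ) :
    ∫ t, charFn g t * ψ t =
      ∫ x, g x * ∫ t, Complex.exp (⟪x, t⟫ * Complex.I) * ψ t := by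
  simp only [charFn, ← integral_mul_const, ← integral_const_mul]
  rw [integral_integral_swap]
  · congr with x
    congr with t
    ring
  · refine Integrable.congr (f := fun z : EuclideanSpace ℝ (Fin d) × EuclideanSpace ℝ (Fin d) =>
      Complex.exp (⟪z.2, z.1⟫ * Complex.I) * (ψ z.1 * (g z.2 : ℂ))) ?_
        (Filter.Eventually.of_forall fun z => ?_)
    · refine (hψ.mul_prod hg.ofReal).bdd_mul (c := 1) ?_ ?_
      · exact Continuous.aestronglyMeasurable (by fun_prop)
      · exact Filter.Eventually.of_forall fun z => (norm_cexp_inner_mul_I _ _).le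
    · simp only [Function.uncurry]
      ring

theorem integrable_mul_exp_neg_mul_sq_norm {φ : EuclideanSpace ℝ (Fin d) → ℂ} (hφ : Continuous φ)
    {c : ℝ} (hc : ∀ t, ‖φ t‖ ≤ c) {b : ℝ} (hb : 0 < b) :
    Integrable fun t => φ t * (Real.exp (-b * ‖t‖ ^ 2) : ℝ) :=
  (integrable_exp_neg_mul_sq_norm hb).ofReal.bdd_mul hφ.aestronglyMeasurable
    (Filter.Eventually.of_forall hc)

theorem integral_exp_neg_sq_norm_sub_div {b : ℝ} (hb : 0 < b) (x : EuclideanSpace ℝ (Fin d)) :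
    ∫ y, Real.exp (-‖y - x‖ ^ 2 / (4 * b)) = (4 * Real.pi * b) ^ ((d : ℝ) / 2) := by
  rw [integral_sub_right_eq_self (fun y => Real.exp (-‖y‖ ^ 2 / (4 * b))) x]
  have h := GaussianFourier.integral_rexp_neg_mul_sq_norm (V := EuclideanSpace ℝ (Fin d))
    (b := (4 * b)⁻¹) (by positivity)
  rw [finrank_euclideanSpace_fin] at h
  rw [show 4 * Real.pi * b = Real.pi / (4 * b)⁻¹ by field_simp, ← h]
  congr with y
  congr 1
  ring

/-- The Gaussian damping justifies Fubini and turns the left side into `∬ g(x) g(y) k(y - x)`, where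
the Gaussian kernel `k` has total mass `(2π)^d`. Bounding `g(y)` by `lam`, then integrating in `y`
and in `x`, gives the claim for every `b`. -/
theorem integral_sq_norm_charFn_mul_exp_le {g : EuclideanSpace ℝ (Fin d) → ℝ} (hg : Integrable g)
    (hg0 : ∀ x, 0 ≤ g x) {lam : ℝ} (hgl : ∀ x, g x ≤ lam) (hg1 : ∫ x, g x ≤ 1)
    {b : ℝ} (hb : 0 < b) :
    ∫ t, ‖charFn g t‖ ^ 2 * Real.exp (-b * ‖t‖ ^ 2) ≤ (2 * Real.pi) ^ d * lam := by
  have hlam : 0 ≤ lam := (hg0 0).trans (hgl 0)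
  set m : EuclideanSpace ℝ (Fin d) → ℝ := fun x =>
    ∫ y, g y * ((Real.pi / b) ^ ((d : ℝ) / 2) * Real.exp (-‖y - x‖ ^ 2 / (4 * b))) with hm
  have hm_le : ∀ x, m x ≤ (2 * Real.pi) ^ d * lam := by
    intro x
    have hi : Integrable fun y : EuclideanSpace ℝ (Fin d) =>
        Real.exp (-‖y - x‖ ^ 2 / (4 * b)) := by
      have := (integrable_exp_neg_mul_sq_norm (d := d) (b := (4 * b)⁻¹)
        (by positivity)).comp_sub_right x
      refine this.congr (Filter.Eventually.of_forall fun y => ?_)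
      simp only
      congr 1
      ring
    calc m x ≤ ∫ y, lam * ((Real.pi / b) ^ ((d : ℝ) / 2) * Real.exp (-‖y - x‖ ^ 2 / (4 * b))) := by
          refine integral_mono_of_nonneg (Filter.Eventually.of_forall fun y => ?_)
            ((hi.const_mul _).const_mul _) (Filter.Eventually.of_forall fun y => ?_)
          · have := hg0 y
            simp only [Pi.zero_apply]
            positivity
          · exact mul_le_mul_of_nonneg_right (hgl y) (by positivity)
      _ = (2 * Real.pi) ^ d * lam := by
          rw [integral_const_mul, integral_const_mul, integral_exp_neg_sq_norm_sub_div hb,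
            ← Real.mul_rpow (by positivity) (by positivity),
            show Real.pi / b * (4 * Real.pi * b) = (2 * Real.pi) ^ (2 : ℝ) by
              rw [Real.rpow_two]; field_simp; ring,
            ← Real.rpow_mul (by positivity), mul_comm]
          congr 1
          rw [← Real.rpow_natCast]
          congr 1
          ring
  have key : ∀ x, ∫ t, Complex.exp (⟪x, t⟫ * Complex.I) *
      (starRingEnd ℂ (charFn g t) * (Real.exp (-b * ‖t‖ ^ 2) : ℝ)) = (m x : ℂ) := by
    intro x
    have h1 : ∀ y, ∫ t, Complex.exp (⟪y, t⟫ * Complex.I) *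
        (Complex.exp (⟪-x, t⟫ * Complex.I) * (Real.exp (-b * ‖t‖ ^ 2) : ℝ)) =
        (((Real.pi / b) ^ ((d : ℝ) / 2) * Real.exp (-‖y - x‖ ^ 2 / (4 * b)) : ℝ) : ℂ) := by
      intro y
      rw [← integral_cexp_inner_mul_exp_neg_mul_sq_norm hb (y - x)]
      congr with t
      rw [← mul_assoc, ← Complex.exp_add, ← add_mul, ← Complex.ofReal_add, ← inner_add_left,
        real_inner_comm t, sub_eq_add_neg]
    have h2 := integral_charFn_mul_eq hg (ψ := fun t => Complex.exp (⟪-x, t⟫ * Complex.I) *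
      (Real.exp (-b * ‖t‖ ^ 2) : ℝ)) (integrable_mul_exp_neg_mul_sq_norm (by fun_prop)
        (fun t => (norm_cexp_inner_mul_I _ _).le) hb)
    simp only [h1] at h2
    have h3 : ∫ t, charFn g t * (Complex.exp (⟪-x, t⟫ * Complex.I) *
        (Real.exp (-b * ‖t‖ ^ 2) : ℝ)) = (m x : ℂ) := by
      rw [h2, hm]
      refine Eq.trans ?_ (integral_ofReal (𝕜 := ℂ))
      simp
    have h4 := congrArg (starRingEnd ℂ) h3
    rw [← integral_conj, Complex.conj_ofReal] at h4
    rw [← h4]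
    congr with t
    simp only [map_mul, ← Complex.exp_conj, Complex.conj_ofReal, Complex.conj_I, inner_neg_left]
    push_cast
    ring_nf
  have hψ : Integrable fun t => starRingEnd ℂ (charFn g t) * (Real.exp (-b * ‖t‖ ^ 2) : ℝ) :=
    integrable_mul_exp_neg_mul_sq_norm (Complex.continuous_conj.comp (continuous_charFn hg))
      (fun t => by simpa using norm_charFn_le g t) hb
  have h5 := integral_charFn_mul_eq hg hψ
  simp only [key] at h5
  have h6 : ∫ t, ‖charFn g t‖ ^ 2 * Real.exp (-b * ‖t‖ ^ 2) = ∫ x, g x * m x := by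
    have h7 : ((∫ t, ‖charFn g t‖ ^ 2 * Real.exp (-b * ‖t‖ ^ 2) : ℝ) : ℂ) =
        ((∫ x, g x * m x : ℝ) : ℂ) := by
      refine (integral_ofReal (𝕜 := ℂ)).symm.trans (Eq.trans ?_ (integral_ofReal (𝕜 := ℂ)))
      simp only [RCLike.ofReal_mul, RCLike.ofReal_pow]
      refine Eq.trans ?_ h5
      congr with t
      rw [← mul_assoc, Complex.mul_conj, Complex.normSq_eq_norm_sq]
      simp
    exact_mod_cast h7
  rw [h6]
  have hm0 : ∀ x, 0 ≤ m x := fun x => integral_nonneg fun y => by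
    have := hg0 y
    simp only [Pi.zero_apply]
    positivity
  calc ∫ x, g x * m x ≤ ∫ x, g x * ((2 * Real.pi) ^ d * lam) :=
        integral_mono_of_nonneg (Filter.Eventually.of_forall fun x => mul_nonneg (hg0 x) (hm0 x))
          (hg.mul_const _) (Filter.Eventually.of_forall fun x =>
            mul_le_mul_of_nonneg_left (hm_le x) (hg0 x))
    _ = (∫ x, g x) * ((2 * Real.pi) ^ d * lam) := integral_mul_const _ _
    _ ≤ _ := mul_le_of_le_one_left (by positivity) hg1

/-- One half of Plancherel's theorem, for bounded densities of mass at most one. -/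
theorem lintegral_sq_norm_charFn_le {g : EuclideanSpace ℝ (Fin d) → ℝ} (hg : Integrable g)
    (hg0 : ∀ x, 0 ≤ g x) {lam : ℝ} (hgl : ∀ x, g x ≤ lam) (hg1 : ∫ x, g x ≤ 1) :
    ∫⁻ t, ENNReal.ofReal (‖charFn g t‖ ^ 2) ≤ ENNReal.ofReal ((2 * Real.pi) ^ d * lam) := by
  have hc := continuous_charFn hg
  -- The damping `1/(n+1)` tends to `0`; Fatou's lemma then passes the uniform bound to the limit.
  let F : ℕ → EuclideanSpace ℝ (Fin d) → ℝ := fun n t =>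
    ‖charFn g t‖ ^ 2 * Real.exp (-(1 / ((n : ℝ) + 1)) * ‖t‖ ^ 2)
  have hFc : ∀ n, Continuous (F n) := fun n => by fun_prop
  have hF : ∀ n, ∫⁻ t, ENNReal.ofReal (F n t) ≤ ENNReal.ofReal ((2 * Real.pi) ^ d * lam) := by
    intro n
    have hb : (0 : ℝ) < 1 / ((n : ℝ) + 1) := by positivity
    rw [← ofReal_integral_eq_lintegral_ofReal]
    · exact ENNReal.ofReal_le_ofReal (integral_sq_norm_charFn_mul_exp_le hg hg0 hgl hg1 hb)
    · refine (integrable_exp_neg_mul_sq_norm hb).bdd_mul (c := (∫ x, ‖g x‖) ^ 2)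
        (hc.norm.pow 2).aestronglyMeasurable (Filter.Eventually.of_forall fun t => ?_)
      rw [norm_pow, norm_norm]
      gcongr
      exact norm_charFn_le g t
    · exact Filter.Eventually.of_forall fun t => by simp only [F, Pi.zero_apply]; positivity
  have hlim : ∀ t, Filter.Tendsto (fun n => ENNReal.ofReal (F n t)) Filter.atTop
      (nhds (ENNReal.ofReal (‖charFn g t‖ ^ 2))) := by
    intro t
    refine ENNReal.tendsto_ofReal ?_
    have h1 : Filter.Tendsto (fun n : ℕ => Real.exp (-(1 / ((n : ℝ) + 1)) * ‖t‖ ^ 2))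
        Filter.atTop (nhds (Real.exp (-0 * ‖t‖ ^ 2))) :=
      ((Real.continuous_exp.tendsto _).comp
        ((tendsto_one_div_add_atTop_nhds_zero_nat (𝕜 := ℝ)).neg.mul_const _))
    have h2 := h1.const_mul (‖charFn g t‖ ^ 2)
    simpa [F] using h2
  calc ∫⁻ t, ENNReal.ofReal (‖charFn g t‖ ^ 2)
      = ∫⁻ t, Filter.liminf (fun n => ENNReal.ofReal (F n t)) Filter.atTop := by
        congr with t
        exact (hlim t).liminf_eq.symm
    _ ≤ Filter.liminf (fun n => ∫⁻ t, ENNReal.ofReal (F n t)) Filter.atTop :=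
        lintegral_liminf_le fun n => (hFc n).measurable.ennreal_ofReal
    _ ≤ _ := Filter.liminf_le_of_frequently_le' (Filter.Frequently.of_forall hF)

/-! ### Truncation and integrability of powers of the characteristic function. -/

/-- The part of `f` above level `lam` has mass at most `K * lam ^ (-q)`. -/
def HasTailBound (f : EuclideanSpace ℝ (Fin d) → ℝ) (K q : ℝ) : Prop :=
  ∀ lam : ℝ, 0 < lam → ∫ x, max (f x - lam) 0 ≤ K * lam ^ (-q)

theorem integrable_max_sub_zero {f : EuclideanSpace ℝ (Fin d) → ℝ} (hf : Integrable f)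
    (hf0 : ∀ x, 0 ≤ f x) {lam : ℝ} (hlam : 0 < lam) :
    Integrable fun x => max (f x - lam) 0 := by
  refine hf.mono' ?_ (Filter.Eventually.of_forall fun x => ?_)
  · exact (by fun_prop : Continuous fun y : ℝ => max (y - lam) 0).comp_aestronglyMeasurable
      hf.aestronglyMeasurable
  · rw [Real.norm_of_nonneg (le_max_right _ _)]
    exact max_le (by linarith) (hf0 x)

theorem integrable_min {f : EuclideanSpace ℝ (Fin d) → ℝ} (hf : Integrable f)
    (hf0 : ∀ x, 0 ≤ f x) {lam : ℝ} (hlam : 0 < lam) : Integrable fun x => min (f x) lam := by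
  refine hf.mono' ?_ (Filter.Eventually.of_forall fun x => ?_)
  · exact (by fun_prop : Continuous fun y : ℝ => min y lam).comp_aestronglyMeasurable
      hf.aestronglyMeasurable
  · rw [Real.norm_of_nonneg (le_min (hf0 x) hlam.le)]
    exact min_le_left _ _

theorem min_eq_sub_max (y lam : ℝ) : min y lam = y - max (y - lam) 0 := by
  rcases le_total y lam with h | h
  · rw [min_eq_left h, max_eq_right (by linarith)]; ring
  · rw [min_eq_right h, max_eq_left (by linarith)]; ring

/-- Where `f > lam`, one has `f = f^p f^(-(p-1)) ≤ f^p lam^(-(p-1))`. The later estimates use the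
`L^p` norm only through this bound. -/
theorem hasTailBound_of_eLpNorm_eq {f : EuclideanSpace ℝ (Fin d) → ℝ} (hf0 : ∀ x, 0 ≤ f x)
    {p : ℝ≥0∞} (hp_one : 1 < p) (hp_top : p < ∞) {M : ℝ≥0} (hf : MemLp f p volume)
    (hM : eLpNorm f p volume = M) :
    HasTailBound f ((M : ℝ) ^ p.toReal) (p.toReal - 1) := by
  have hp0 : p ≠ 0 := (zero_lt_one.trans hp_one).ne'
  have hp1 : 1 < p.toReal := by
    rw [← ENNReal.toReal_one]
    exact (ENNReal.toReal_lt_toReal ENNReal.one_ne_top hp_top.ne).2 hp_one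
  have hint := hf.integrable_norm_rpow hp0 hp_top.ne
  have hpos : 0 ≤ ∫ x, ‖f x‖ ^ p.toReal := integral_nonneg fun x => by
    simp only [Pi.zero_apply]; positivity
  have hMi : ∫ x, ‖f x‖ ^ p.toReal = (M : ℝ) ^ p.toReal := by
    have h1 := hf.eLpNorm_eq_integral_rpow_norm hp0 hp_top.ne
    rw [hM] at h1
    have h2 := congrArg ENNReal.toReal h1
    rw [ENNReal.toReal_ofReal (by positivity), ENNReal.coe_toReal] at h2
    rw [h2, ← Real.rpow_mul hpos, inv_mul_cancel₀ (by positivity), Real.rpow_one]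
  intro lam hlam
  calc ∫ x, max (f x - lam) 0 ≤ ∫ x, ‖f x‖ ^ p.toReal * lam ^ (-(p.toReal - 1)) := by
        refine integral_mono_of_nonneg (Filter.Eventually.of_forall fun x => le_max_right _ _)
          (hint.mul_const _) (Filter.Eventually.of_forall fun x => ?_)
        simp only
        refine max_le ?_ (by positivity)
        rcases le_or_gt (f x) lam with h | h
        · exact (sub_nonpos.2 h).trans (by positivity)
        · rw [Real.norm_of_nonneg (hf0 x)]
          have hfx : 0 < f x := hlam.trans h
          have h3 : f x = f x ^ p.toReal * f x ^ (-(p.toReal - 1)) := by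
            rw [← Real.rpow_add hfx]; simp
          calc f x - lam ≤ f x := by linarith
            _ = _ := h3
            _ ≤ _ := mul_le_mul_of_nonneg_left
                (Real.rpow_le_rpow_of_nonpos hlam h.le (by linarith)) (by positivity)
    _ = _ := by rw [integral_mul_const, hMi]

/-- The part above `lam` contributes at most `t/2` to the characteristic function, so on this level
set the bounded part contributes at least `t/2`; Markov's inequality and Plancherel conclude. -/
theorem volume_le_norm_charFn_le {f : EuclideanSpace ℝ (Fin d) → ℝ} (hf : Integrable f)
    (hf0 : ∀ x, 0 ≤ f x) (hf1 : ∫ x, f x = 1) {lam t : ℝ} (hlam : 0 < lam) (ht : 0 < t)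
    (hb : ∫ x, max (f x - lam) 0 ≤ t / 2) :
    volume {u | t ≤ ‖charFn f u‖} ≤ ENNReal.ofReal (4 * (2 * Real.pi) ^ d * lam * t ^ (-2 : ℝ)) := by
  have hg := integrable_min hf hf0 hlam
  have hbi := integrable_max_sub_zero hf hf0 hlam
  have hsub : ∀ u, t ≤ ‖charFn f u‖ → (t / 2) ^ 2 ≤ ‖charFn (fun x => min (f x) lam) u‖ ^ 2 := by
    intro u hu
    have h1 : charFn (fun x => min (f x) lam) u =
        charFn f u - charFn (fun x => max (f x - lam) 0) u := by
      rw [← charFn_sub hf hbi]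
      simp only [min_eq_sub_max]
    have h2 : ‖charFn (fun x => max (f x - lam) 0) u‖ ≤ t / 2 := by
      refine (norm_charFn_le _ u).trans ?_
      simpa [abs_of_nonneg] using hb
    have h3 := norm_sub_norm_le (charFn f u) (charFn (fun x => max (f x - lam) 0) u)
    rw [h1]
    gcongr
    linarith
  have hP := lintegral_sq_norm_charFn_le hg (fun x => le_min (hf0 x) hlam.le)
    (fun x => min_le_right _ _) ((integral_mono hg hf fun x => min_le_left _ _).trans hf1.le)
  have hmk := mul_meas_ge_le_lintegral
    (((continuous_charFn hg).norm.pow 2).measurable.ennreal_ofReal) (μ := volume)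
    (ENNReal.ofReal ((t / 2) ^ 2))
  have hle : ENNReal.ofReal ((t / 2) ^ 2) * volume {u | t ≤ ‖charFn f u‖} ≤
      ENNReal.ofReal ((2 * Real.pi) ^ d * lam) := by
    refine le_trans ?_ (hmk.trans hP)
    exact mul_le_mul_right (measure_mono fun u hu => ENNReal.ofReal_le_ofReal (hsub u hu)) _
  have h0 : (0 : ℝ) < (t / 2) ^ 2 := by positivity
  rw [mul_comm, ← ENNReal.le_div_iff_mul_le (Or.inl (ENNReal.ofReal_pos.2 h0).ne') (Or.inl (by simp)),
    ← ENNReal.ofReal_div_of_pos h0] at hle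
  refine hle.trans_eq ?_
  congr 1
  rw [Real.rpow_neg ht.le, Real.rpow_two]
  field_simp
  ring

theorem lintegral_norm_charFn_pow_le {f : EuclideanSpace ℝ (Fin d) → ℝ} (hf : Integrable f)
    (hf0 : ∀ x, 0 ≤ f x) (hf1 : ∫ x, f x = 1) {K q : ℝ} (hK : 0 < K) (hq : 0 < q)
    (hfK : HasTailBound f K q) {N : ℕ} (hN : 3 + 1 / q ≤ N) :
    ∫⁻ t, ENNReal.ofReal (‖charFn f t‖ ^ N) ≤
      ENNReal.ofReal (N * (4 * (2 * Real.pi) ^ d * (2 * K) ^ (1 / q))) := by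
  have hq' : 0 < 1 / q := by positivity
  have hN0 : (0 : ℝ) < N := by linarith
  have hle1 : ∀ t, ‖charFn f t‖ ≤ 1 := fun t => by
    refine (norm_charFn_le f t).trans_eq ?_
    rw [← hf1]
    congr with x
    exact Real.norm_of_nonneg (hf0 x)
  set A : ℝ := 4 * (2 * Real.pi) ^ d * (2 * K) ^ (1 / q) with hA
  have hlc := lintegral_rpow_eq_lintegral_meas_le_mul volume
    (f := fun t => ‖charFn f t‖) (Filter.Eventually.of_forall fun t => norm_nonneg _)
    (continuous_charFn hf).norm.aemeasurable hN0
  simp only [Real.rpow_natCast] at hlc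
  rw [hlc, ENNReal.ofReal_mul hN0.le]
  gcongr
  calc ∫⁻ t in Set.Ioi 0, volume {a | t ≤ ‖charFn f a‖} * ENNReal.ofReal (t ^ ((N : ℝ) - 1))
      ≤ ∫⁻ t in Set.Ioi (0 : ℝ), (Set.Ioc 0 1).indicator (fun _ => ENNReal.ofReal A) t := by
        refine setLIntegral_mono' measurableSet_Ioi fun t ht => ?_
        have ht0 : 0 < t := ht
        rcases le_or_gt t 1 with h | h
        · rw [Set.indicator_of_mem (Set.mem_Ioc.2 ⟨ht0, h⟩)]
          -- This level makes the tail bound exactly `t/2`. The level set then has volume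
          -- `O(t^(-2-1/q))`, which against `t^(N-1)` leaves the exponent `N - 3 - 1/q ≥ 0`: hence
          -- the condition on `N`.
          have hlam : 0 < (2 * K / t) ^ (1 / q) := by positivity
          have hb : ∫ x, max (f x - (2 * K / t) ^ (1 / q)) 0 ≤ t / 2 := by
            refine (hfK _ hlam).trans_eq ?_
            rw [← Real.rpow_mul (by positivity), show 1 / q * -q = -1 by field_simp,
              Real.rpow_neg_one]
            field_simp
          refine (mul_le_mul_left (volume_le_norm_charFn_le hf hf0 hf1 hlam ht0 hb) _).trans ?_
          rw [← ENNReal.ofReal_mul (by positivity)]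
          refine ENNReal.ofReal_le_ofReal ?_
          rw [Real.div_rpow (by positivity) ht0.le, div_eq_mul_inv, ← Real.rpow_neg ht0.le]
          calc _ = A * (t ^ (-(1 / q)) * t ^ (-2 : ℝ) * t ^ ((N : ℝ) - 1)) := by rw [hA]; ring
            _ = A * t ^ (-(1 / q) + -2 + ((N : ℝ) - 1)) := by
                rw [Real.rpow_add ht0, Real.rpow_add ht0]
            _ ≤ A * 1 := by
                gcongr
                exact Real.rpow_le_one ht0.le h (by linarith)
            _ = A := mul_one A
        · have : {a | t ≤ ‖charFn f a‖} = ∅ := by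
            ext a
            simpa using (hle1 a).trans_lt h
          simp [this]
    _ ≤ ∫⁻ t, (Set.Ioc 0 1).indicator (fun _ => ENNReal.ofReal A) t := setLIntegral_le_lintegral _ _
    _ = ENNReal.ofReal A := by
        rw [lintegral_indicator measurableSet_Ioc]
        simp

theorem integrable_and_integral_norm_charFn_pow_le {f : EuclideanSpace ℝ (Fin d) → ℝ}
    (hf : Integrable f) (hf0 : ∀ x, 0 ≤ f x) (hf1 : ∫ x, f x = 1) {K q : ℝ} (hK : 0 < K)
    (hq : 0 < q) (hfK : HasTailBound f K q) {N : ℕ} (hN : 3 + 1 / q ≤ N) :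
    (Integrable fun t => ‖charFn f t‖ ^ N) ∧
      ∫ t, ‖charFn f t‖ ^ N ≤ N * (4 * (2 * Real.pi) ^ d * (2 * K) ^ (1 / q)) := by
  have h := lintegral_norm_charFn_pow_le hf hf0 hf1 hK hq hfK hN
  have hm : AEStronglyMeasurable (fun t => ‖charFn f t‖ ^ N) volume :=
    ((continuous_charFn hf).norm.pow N).aestronglyMeasurable
  have h0 : 0 ≤ᵐ[volume] fun t => ‖charFn f t‖ ^ N :=
    Filter.Eventually.of_forall fun t => by simp only [Pi.zero_apply]; positivity
  have hi : Integrable fun t => ‖charFn f t‖ ^ N :=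
    ⟨hm, (hasFiniteIntegral_iff_ofReal h0).2 (h.trans_lt ENNReal.ofReal_lt_top)⟩
  refine ⟨hi, ?_⟩
  rw [← ofReal_integral_eq_lintegral_ofReal hi h0] at h
  exact (ENNReal.ofReal_le_ofReal_iff (by positivity)).1 h

/-! ### A uniform gap below `1` away from the origin, and Gaussian-type decay. -/

/-- Since `1 - cos (a - b) = |e^{ia} - e^{ib}|² / 2`, this is the triangle inequality through `1`,
squared. -/
theorem one_sub_cos_sub_le (a b : ℝ) :
    1 - Real.cos (a - b) ≤ 2 * (1 - Real.cos a) + 2 * (1 - Real.cos b) := by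
  rw [Real.cos_sub]
  nlinarith [sq_nonneg (Real.cos a + Real.cos b - 2), sq_nonneg (Real.sin a + Real.sin b),
    Real.sin_sq_add_cos_sq a, Real.sin_sq_add_cos_sq b]

/-- The factor `4` matches `one_sub_cos_sub_le`: two phases with `1 - cos < ε` cannot differ by a
nontrivial multiple of `2π/m`, which makes the translates in `mul_volume_phase_le` disjoint. -/
theorem exists_pos_le_one_sub_cos (m : ℕ) :
    ∃ ε : ℝ, 0 < ε ∧
      ∀ j : ℕ, 0 < j → j < m → 4 * ε ≤ 1 - Real.cos (2 * Real.pi * j / m) := by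
  have hpos : ∀ j ∈ Finset.Ioo 0 m, 0 < (1 - Real.cos (2 * Real.pi * j / m)) / 4 := by
    intro j hj
    rw [Finset.mem_Ioo] at hj
    have hj0 : (0 : ℝ) < j := by exact_mod_cast hj.1
    have hjm : (j : ℝ) < m := by exact_mod_cast hj.2
    have hne : Real.cos (2 * Real.pi * j / m) ≠ 1 := by
      intro h
      have h1 := (Real.cos_eq_one_iff_of_lt_of_lt (x := 2 * Real.pi * j / m)
        (by have := hj0.trans hjm
            have : 0 < 2 * Real.pi * j / m := by positivity
            linarith [Real.pi_pos]) (by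
          rw [div_lt_iff₀ (by linarith)]
          exact mul_lt_mul_of_pos_left hjm (by positivity))).1 h
      have : 0 < 2 * Real.pi * j / m := by have := hj0.trans hjm; positivity
      linarith
    have := lt_of_le_of_ne (Real.cos_le_one (2 * Real.pi * j / m)) hne
    linarith
  rcases (Finset.Ioo 0 m).eq_empty_or_nonempty with he | hne
  · refine ⟨1, one_pos, fun j h0 h1 => ?_⟩
    have : j ∈ Finset.Ioo 0 m := Finset.mem_Ioo.2 ⟨h0, h1⟩
    simp [he] at this
  · obtain ⟨i, hi, hmin⟩ := Finset.exists_min_image (Finset.Ioo 0 m)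
      (fun j : ℕ => (1 - Real.cos (2 * Real.pi * j / m)) / 4) hne
    refine ⟨(1 - Real.cos (2 * Real.pi * i / m)) / 4, hpos i hi, fun j h0 h1 => ?_⟩
    have := hmin j (Finset.mem_Ioo.2 ⟨h0, h1⟩)
    linarith

theorem measurableSet_phase (u : EuclideanSpace ℝ (Fin d)) (θ R ε : ℝ) :
    MeasurableSet {x : EuclideanSpace ℝ (Fin d) |
      ‖x‖ ≤ R ∧ 1 - Real.cos (⟪x, u⟫ - θ) < ε} := by
  have h1 : MeasurableSet {x : EuclideanSpace ℝ (Fin d) | ‖x‖ ≤ R} :=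
    measurableSet_le (by fun_prop) (by fun_prop)
  have h2 : MeasurableSet {x : EuclideanSpace ℝ (Fin d) | 1 - Real.cos (⟪x, u⟫ - θ) < ε} :=
    measurableSet_lt (by fun_prop) (by fun_prop)
  exact h1.inter h2

/-- The part of a ball on which `⟪x, u⟫` is close to `θ` modulo `2π` has small volume: its `m`
translates along `u` by multiples of `2π / (m * ‖u‖)` are disjoint. -/
theorem mul_volume_phase_le {u : EuclideanSpace ℝ (Fin d)} (hu : 1 / 2 ≤ ‖u‖) (θ R : ℝ) {m : ℕ}
    {ε : ℝ} (hε : ∀ j : ℕ, 0 < j → j < m → 4 * ε ≤ 1 - Real.cos (2 * Real.pi * j / m)) :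
    m * volume {x : EuclideanSpace ℝ (Fin d) | ‖x‖ ≤ R ∧ 1 - Real.cos (⟪x, u⟫ - θ) < ε} ≤
      volume (Metric.closedBall (0 : EuclideanSpace ℝ (Fin d)) (R + 4 * Real.pi)) := by
  have hu0 : 0 < ‖u‖ := by linarith
  set A := {x : EuclideanSpace ℝ (Fin d) | ‖x‖ ≤ R ∧ 1 - Real.cos (⟪x, u⟫ - θ) < ε} with hA
  have hAm : MeasurableSet A := measurableSet_phase u θ R ε
  let T : ℕ → Set (EuclideanSpace ℝ (Fin d)) := fun k =>
    (fun x => x + (-(2 * Real.pi * k / m / ‖u‖ ^ 2)) • u) ⁻¹' A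
  have hTm : ∀ k, MeasurableSet (T k) := fun k =>
    (by fun_prop : Measurable fun x => x + (-(2 * Real.pi * k / m / ‖u‖ ^ 2)) • u) hAm
  have hinner : ∀ (x : EuclideanSpace ℝ (Fin d)) (k : ℕ),
      ⟪x + (-(2 * Real.pi * k / m / ‖u‖ ^ 2)) • u, u⟫ = ⟪x, u⟫ - 2 * Real.pi * k / m := by
    intro x k
    rw [inner_add_left, inner_smul_left, real_inner_self_eq_norm_sq]
    simp
    field_simp
    ring
  have hlt : ∀ i j, i < j → j < m → Disjoint (T i) (T j) := by
    intro i j hij hj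
    rw [Set.disjoint_left]
    intro x hxi hxj
    have h1 := hxi.2
    have h2 := hxj.2
    rw [hinner] at h1 h2
    have h3 := one_sub_cos_sub_le (⟪x, u⟫ - 2 * Real.pi * i / m - θ)
      (⟪x, u⟫ - 2 * Real.pi * j / m - θ)
    have h4 := hε (j - i) (by omega) (by omega)
    have h5 : ⟪x, u⟫ - 2 * Real.pi * i / m - θ - (⟪x, u⟫ - 2 * Real.pi * j / m - θ) =
        2 * Real.pi * (j - i : ℕ) / m := by
      rw [Nat.cast_sub hij.le]; ring
    rw [h5] at h3
    linarith
  have hdisj : (Finset.range m : Set ℕ).PairwiseDisjoint T := by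
    intro i hi j hj hij
    have hi' : i < m := by simpa using hi
    have hj' : j < m := by simpa using hj
    rcases lt_or_gt_of_ne hij with h | h
    · exact hlt i j h hj'
    · exact (hlt j i h hi').symm
  calc (m : ℝ≥0∞) * volume A = ∑ k ∈ Finset.range m, volume (T k) := by
        have : ∀ k, volume (T k) = volume A := fun k => measure_preimage_add_right _ _ _
        simp [this]
    _ = volume (⋃ k ∈ Finset.range m, T k) :=
        (measure_biUnion_finset hdisj fun k _ => hTm k).symm
    _ ≤ _ := by
        refine measure_mono (Set.iUnion₂_subset fun k hk x hx => ?_)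
        have hk' : (k : ℝ) ≤ m := by exact_mod_cast (Finset.mem_range.1 hk).le
        have hm0 : (0 : ℝ) < m := by exact_mod_cast (Nat.zero_le k).trans_lt (Finset.mem_range.1 hk)
        have h1 : ‖x + (-(2 * Real.pi * k / m / ‖u‖ ^ 2)) • u‖ ≤ R := hx.1
        -- The shifts have length at most `2π / ‖u‖ ≤ 4π`, so the translates stay in the enlarged
        -- ball; this is where `‖u‖ ≥ 1/2` enters.
        have h2 : ‖(2 * Real.pi * k / m / ‖u‖ ^ 2) • u‖ ≤ 4 * Real.pi := by
          rw [norm_smul, Real.norm_of_nonneg (by positivity)]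
          calc 2 * Real.pi * k / m / ‖u‖ ^ 2 * ‖u‖ = 2 * Real.pi * (k / m) / ‖u‖ := by
                field_simp
            _ ≤ 2 * Real.pi * 1 / (1 / 2) := by
                gcongr
                exact (div_le_one hm0).2 hk'
            _ = _ := by ring
        rw [mem_closedBall_zero_iff]
        calc ‖x‖ = ‖(x + (-(2 * Real.pi * k / m / ‖u‖ ^ 2)) • u) +
              (2 * Real.pi * k / m / ‖u‖ ^ 2) • u‖ := by
                congr 1
                rw [add_assoc, ← add_smul]
                simp
          _ ≤ _ := (norm_add_le _ _).trans (add_le_add h1 h2)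

theorem integrable_mul_cos {f : EuclideanSpace ℝ (Fin d) → ℝ} (hf : Integrable f)
    (u : EuclideanSpace ℝ (Fin d)) (a θ : ℝ) :
    Integrable fun x => Real.cos (a * (⟪x, u⟫ - θ)) * f x :=
  hf.bdd_mul (c := 1) (Continuous.aestronglyMeasurable (by fun_prop))
    (Filter.Eventually.of_forall fun x => Real.abs_cos_le_one _)

theorem re_exp_mul_charFn {f : EuclideanSpace ℝ (Fin d) → ℝ} (hf : Integrable f)
    (u : EuclideanSpace ℝ (Fin d)) (θ : ℝ) :
    (Complex.exp (-θ * Complex.I) * charFn f u).re = ∫ x, Real.cos (⟪x, u⟫ - θ) * f x := by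
  rw [charFn, ← integral_const_mul]
  refine (integral_re ((integrable_cexp_inner_mul_ofReal hf u).const_mul _)).symm.trans ?_
  congr with x
  rw [← mul_assoc, ← Complex.exp_add, ← add_mul,
    show (-(θ : ℂ) + ⟪x, u⟫) = ((⟪x, u⟫ - θ : ℝ) : ℂ) by push_cast; ring]
  exact (Complex.re_mul_ofReal _ _).trans (by rw [Complex.exp_ofReal_mul_I_re])

theorem integral_cos_mul_le_norm_charFn {f : EuclideanSpace ℝ (Fin d) → ℝ} (hf : Integrable f)
    (u : EuclideanSpace ℝ (Fin d)) (θ : ℝ) :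
    ∫ x, Real.cos (⟪x, u⟫ - θ) * f x ≤ ‖charFn f u‖ := by
  rw [← re_exp_mul_charFn hf]
  refine (Complex.re_le_norm _).trans_eq ?_
  rw [norm_mul, ← Complex.ofReal_neg, Complex.norm_exp_ofReal_mul_I, one_mul]

theorem exists_norm_charFn_eq_integral_cos {f : EuclideanSpace ℝ (Fin d) → ℝ} (hf : Integrable f)
    (u : EuclideanSpace ℝ (Fin d)) :
    ∃ θ, ‖charFn f u‖ = ∫ x, Real.cos (⟪x, u⟫ - θ) * f x := by
  refine ⟨Complex.arg (charFn f u), ?_⟩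
  rw [← re_exp_mul_charFn hf]
  conv_rhs => rw [← Complex.norm_mul_exp_arg_mul_I (charFn f u)]
  rw [mul_left_comm, Complex.norm_mul_exp_arg_mul_I, ← Complex.exp_add]
  simp

/-- Integrate `1 - cos 2α ≤ 4 (1 - cos α)`, using at `u` the phase `θ` that realises the modulus and
at `2u` the phase `2θ`, which still bounds the modulus from below. -/
theorem one_sub_norm_charFn_two_smul_le {f : EuclideanSpace ℝ (Fin d) → ℝ} (hf : Integrable f)
    (hf0 : ∀ x, 0 ≤ f x) (hf1 : ∫ x, f x = 1) (u : EuclideanSpace ℝ (Fin d)) :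
    1 - ‖charFn f ((2 : ℝ) • u)‖ ≤ 4 * (1 - ‖charFn f u‖) := by
  obtain ⟨θ, hθ⟩ := exists_norm_charFn_eq_integral_cos hf u
  have h2 := integral_cos_mul_le_norm_charFn hf ((2 : ℝ) • u) (2 * θ)
  have hi1 : Integrable fun x => Real.cos (⟪x, u⟫ - θ) * f x := by
    simpa using integrable_mul_cos hf u 1 θ
  have hi2 : Integrable fun x => Real.cos (⟪x, (2 : ℝ) • u⟫ - 2 * θ) * f x := by
    simpa [inner_smul_right, mul_sub] using integrable_mul_cos hf u 2 θ
  have h3 : ∫ x, (f x - Real.cos (⟪x, (2 : ℝ) • u⟫ - 2 * θ) * f x) ≤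
      ∫ x, 4 * (f x - Real.cos (⟪x, u⟫ - θ) * f x) := by
    refine integral_mono (hf.sub hi2) ((hf.sub hi1).const_mul 4) fun x => ?_
    have h4 : Real.cos (⟪x, (2 : ℝ) • u⟫ - 2 * θ) = 2 * Real.cos (⟪x, u⟫ - θ) ^ 2 - 1 := by
      rw [← Real.cos_two_mul, inner_smul_right]
      ring_nf
    simp only [h4]
    nlinarith [hf0 x, mul_nonneg (hf0 x) (sq_nonneg (1 - Real.cos (⟪x, u⟫ - θ)))]
  rw [integral_sub hf hi2, integral_const_mul, integral_sub hf hi1, hf1, ← hθ] at h3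
  linarith

/-- Characteristic functions are bounded away from `1` in modulus away from the origin, uniformly
over densities with a given second moment and tail bound. -/
theorem exists_norm_charFn_le_one_sub (d : ℕ) {K q : ℝ} (hK : 0 < K) (hq : 0 < q) :
    ∃ γ : ℝ, 0 < γ ∧ ∀ f : EuclideanSpace ℝ (Fin d) → ℝ, Integrable f → (∀ x, 0 ≤ f x) →
      ∫ x, f x = 1 → Integrable (fun x => ‖x‖ ^ 2 * f x) → ∫ x, ‖x‖ ^ 2 * f x = d →
      HasTailBound f K q → ∀ u, 1 / 2 ≤ ‖u‖ → ‖charFn f u‖ ≤ 1 - γ := by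
  -- Mass budget: at most `d/(2d+1) ≤ 1/2` lies outside radius `R`, at most `1/8` above level `lam`,
  -- and at most `lam * vol A ≤ 1/8` below that level on the slabs `A`. At least `1/4` remains, on
  -- which `1 - cos ≥ ε`; hence the gap `ε/4`.
  set R : ℝ := Real.sqrt (2 * d + 1) with hR
  have hR2 : R ^ 2 = 2 * d + 1 := Real.sq_sqrt (by positivity)
  set lam : ℝ := (8 * K) ^ (1 / q) with hlam
  have hlam0 : 0 < lam := by positivity
  set V := volume (Metric.closedBall (0 : EuclideanSpace ℝ (Fin d)) (R + 4 * Real.pi)) with hV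
  have hVtop : V ≠ ∞ := (isCompact_closedBall _ _).measure_lt_top.ne
  obtain ⟨m, hm⟩ := exists_nat_ge (8 * lam * V.toReal)
  -- Taking `m + 1` translates spares a proof that `m` is positive.
  obtain ⟨ε, hε0, hε⟩ := exists_pos_le_one_sub_cos (m + 1)
  refine ⟨ε / 4, by positivity, fun f hf hf0 hf1 hf2 hf2d hfK u hu => ?_⟩
  obtain ⟨θ, hθ⟩ := exists_norm_charFn_eq_integral_cos hf u
  set A := {x : EuclideanSpace ℝ (Fin d) | ‖x‖ ≤ R ∧ 1 - Real.cos (⟪x, u⟫ - θ) < ε} with hA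
  have hAm : MeasurableSet A := measurableSet_phase u θ R ε
  have hAV := mul_volume_phase_le hu θ R hε
  rw [← hA, ← hV] at hAV
  have hAtop : volume A ≠ ∞ := by
    refine ne_top_of_le_ne_top hVtop (le_trans ?_ hAV)
    refine le_mul_of_one_le_left zero_le ?_
    push_cast
    exact le_add_self
  have hAreal : lam * volume.real A ≤ 1 / 8 := by
    have h1 := ENNReal.toReal_mono hVtop hAV
    rw [ENNReal.toReal_mul] at h1
    push_cast at h1
    rw [ENNReal.toReal_add (by simp) (by simp), ENNReal.toReal_natCast, ENNReal.toReal_one] at h1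
    have h2 : (m + 1) * volume.real A ≤ V.toReal := h1
    have h3 : (0 : ℝ) < m + 1 := by positivity
    have h4 : (m + 1) * (8 * (lam * volume.real A)) ≤ (m + 1) * 1 := by
      nlinarith [mul_le_mul_of_nonneg_left h2 hlam0.le]
    linarith [le_of_mul_le_mul_left h4 h3]
  have htail : ∫ x, max (f x - lam) 0 ≤ 1 / 8 := by
    refine (hfK lam hlam0).trans_eq ?_
    rw [hlam, ← Real.rpow_mul (by positivity), show 1 / q * -q = -1 by field_simp,
      Real.rpow_neg_one]
    field_simp
  have hi1 : Integrable fun x => Real.cos (⟪x, u⟫ - θ) * f x := by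
    simpa using integrable_mul_cos hf u 1 θ
  have hiA : Integrable (A.indicator fun _ => lam) :=
    (integrable_indicator_iff hAm).2 (integrableOn_const hAtop)
  have hib := integrable_max_sub_zero hf hf0 hlam0
  have hi2 : Integrable fun x => f x - (R ^ 2)⁻¹ * (‖x‖ ^ 2 * f x) := hf.sub (hf2.const_mul _)
  have hi3 : Integrable fun x => f x - (R ^ 2)⁻¹ * (‖x‖ ^ 2 * f x) -
      A.indicator (fun _ => lam) x := hi2.sub hiA
  -- Pointwise, the bracket is nonpositive on `A` and outside the ball, and at most `f x` elsewhere,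
  -- where `1 - cos ≥ ε`.
  have hlow : ∫ x, ε * (((f x - (R ^ 2)⁻¹ * (‖x‖ ^ 2 * f x)) - A.indicator (fun _ => lam) x) -
      max (f x - lam) 0) ≤ ∫ x, (f x - Real.cos (⟪x, u⟫ - θ) * f x) := by
    refine integral_mono ((hi3.sub hib).const_mul ε)
      (hf.sub hi1) fun x => ?_
    have hc1 := Real.cos_le_one (⟪x, u⟫ - θ)
    have hfx := hf0 x
    have hq1 : 0 ≤ (R ^ 2)⁻¹ * (‖x‖ ^ 2 * f x) := by positivity
    have hq2 := le_max_right (f x - lam) 0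
    have hq3 := le_max_left (f x - lam) 0
    have hq4 : 0 ≤ A.indicator (fun _ => lam) x := Set.indicator_nonneg (fun _ _ => hlam0.le) x
    have hrhs : 0 ≤ f x - Real.cos (⟪x, u⟫ - θ) * f x := by nlinarith
    simp only
    rcases le_or_gt ‖x‖ R with hx | hx
    · rcases lt_or_ge (1 - Real.cos (⟪x, u⟫ - θ)) ε with hc | hc
      · have hxA : x ∈ A := ⟨hx, hc⟩
        rw [Set.indicator_of_mem hxA]
        refine le_trans (mul_nonpos_of_nonneg_of_nonpos hε0.le ?_) hrhs
        linarith
      · calc _ ≤ ε * f x := by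
              gcongr
              linarith
          _ ≤ (1 - Real.cos (⟪x, u⟫ - θ)) * f x := by gcongr
          _ = _ := by ring
    · refine le_trans (mul_nonpos_of_nonneg_of_nonpos hε0.le ?_) hrhs
      have h1 : 1 ≤ (R ^ 2)⁻¹ * ‖x‖ ^ 2 := by
        rw [← div_eq_inv_mul, one_le_div (by rw [hR2]; positivity)]
        exact pow_le_pow_left₀ (Real.sqrt_nonneg _) hx.le 2
      nlinarith
  have hid : ∫ x, A.indicator (fun _ => lam) x = lam * volume.real A := by
    rw [integral_indicator hAm]
    simp [mul_comm]
  rw [integral_const_mul, integral_sub hi3 hib, integral_sub hi2 hiA, integral_sub hf (hf2.const_mul _),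
    integral_const_mul, integral_sub hf hi1, ← hθ, hf1, hf2d, hid, hR2] at hlow
  have hd : (2 * (d : ℝ) + 1)⁻¹ * d ≤ 1 / 2 := by
    rw [← div_eq_inv_mul, div_le_iff₀ (by positivity)]
    linarith
  have : ε * (1 / 4) ≤ 1 - ‖charFn f u‖ := le_trans (by gcongr; linarith) hlow
  linarith

/-- Doubling `u` multiplies `‖u‖²` by `4` and `1 - ‖φ‖` by at most `4`, so the gap on `‖u‖ ≥ 1/2`
propagates inwards as `γ‖u‖²`. The cap `c ≤ 1/2` lets the same exponential dominate the Gaussian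
factors near the origin. -/
theorem exists_norm_charFn_le_exp (d : ℕ) {K q : ℝ} (hK : 0 < K) (hq : 0 < q) :
    ∃ c : ℝ, 0 < c ∧ c ≤ 1 / 2 ∧ ∀ f : EuclideanSpace ℝ (Fin d) → ℝ, Integrable f →
      (∀ x, 0 ≤ f x) → ∫ x, f x = 1 → Integrable (fun x => ‖x‖ ^ 2 * f x) →
      ∫ x, ‖x‖ ^ 2 * f x = d → HasTailBound f K q →
      ∀ u, ‖charFn f u‖ ≤ Real.exp (-c * min 1 (‖u‖ ^ 2)) := by
  obtain ⟨γ, hγ, h⟩ := exists_norm_charFn_le_one_sub d hK hq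
  refine ⟨min γ (1 / 2), by positivity, min_le_right _ _,
    fun f hf hf0 hf1 hf2 hf2d hfK u => ?_⟩
  have hgap := h f hf hf0 hf1 hf2 hf2d hfK
  -- Here `k` is the number of doublings that suffice to reach `‖u‖ ≥ 1/2`.
  have hsmall : ∀ (k : ℕ) (u : EuclideanSpace ℝ (Fin d)), 1 / 2 ≤ 2 ^ k * ‖u‖ → ‖u‖ ≤ 1 →
      ‖charFn f u‖ ≤ 1 - γ * ‖u‖ ^ 2 := by
    intro k
    induction k with
    | zero =>
      intro u hu hu1
      have h1 := hgap u (by simpa using hu)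
      have h2 : ‖u‖ ^ 2 ≤ 1 := pow_le_one₀ (norm_nonneg _) hu1
      nlinarith
    | succ k ih =>
      intro u hu hu1
      rcases le_or_gt (1 / 2) ‖u‖ with hu2 | hu2
      · have h1 := hgap u hu2
        have h2 : ‖u‖ ^ 2 ≤ 1 := pow_le_one₀ (norm_nonneg _) hu1
        nlinarith
      · have hn : ‖(2 : ℝ) • u‖ = 2 * ‖u‖ := by rw [norm_smul]; simp
        have h1 := ih ((2 : ℝ) • u) (by rw [hn]; rw [pow_succ] at hu; linarith)
          (by rw [hn]; linarith)
        have h2 := one_sub_norm_charFn_two_smul_le hf hf0 hf1 u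
        rw [hn] at h1
        nlinarith
  have hall : ‖charFn f u‖ ≤ 1 - γ * min 1 (‖u‖ ^ 2) := by
    rcases le_or_gt ‖u‖ 1 with hu1 | hu1
    · rw [min_eq_right (pow_le_one₀ (norm_nonneg _) hu1)]
      rcases (norm_nonneg u).eq_or_lt with h0 | h0
      · rw [← h0]
        refine (norm_charFn_le f u).trans_eq ?_
        simp [abs_of_nonneg (hf0 _), hf1]
      · obtain ⟨k, hk⟩ := pow_unbounded_of_one_lt (1 / 2 / ‖u‖) (one_lt_two : (1 : ℝ) < 2)
        exact hsmall k u ((div_lt_iff₀ h0).1 hk).le hu1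
    · rw [min_eq_left (one_le_pow₀ hu1.le), mul_one]
      exact hgap u (by linarith)
  have h0 : 0 ≤ min 1 (‖u‖ ^ 2) := by positivity
  calc ‖charFn f u‖ ≤ 1 - min γ (1 / 2) * min 1 (‖u‖ ^ 2) := by
        refine hall.trans ?_
        gcongr
        exact min_le_left _ _
    _ ≤ _ := by
        have := Real.add_one_le_exp (-min γ (1 / 2) * min 1 (‖u‖ ^ 2))
        linarith

/-! ### Taylor expansion at the origin under a `2 + s` moment. -/

/-- The cubic remainder serves for `|y| ≤ 1` and the trivial quadratic bound for `|y| > 1`; the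
exponent `2 + s` lies between `2` and `3`. -/
theorem norm_exp_mul_I_sub_taylor_le {s : ℝ} (hs0 : 0 < s) (hs1 : s ≤ 1) (y : ℝ) :
    ‖Complex.exp (y * Complex.I) - 1 - y * Complex.I + (y : ℂ) ^ 2 / 2‖ ≤ 4 * |y| ^ (2 + s) := by
  have hn : ‖(y : ℂ) * Complex.I‖ = |y| := by simp
  rcases le_or_gt |y| 1 with hy | hy
  · have h := Complex.exp_bound (x := y * Complex.I) (by rw [hn]; exact hy) (n := 3) (by norm_num)
    rw [hn] at h
    have h1 : ∑ m ∈ Finset.range 3, ((y : ℂ) * Complex.I) ^ m / (m.factorial : ℂ) =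
        1 + y * Complex.I - (y : ℂ) ^ 2 / 2 := by
      simp [Finset.sum_range_succ, mul_pow, Complex.I_sq, Nat.factorial]
      ring
    rw [h1] at h
    calc _ = ‖Complex.exp (y * Complex.I) - (1 + y * Complex.I - (y : ℂ) ^ 2 / 2)‖ := by
          congr 1; ring
      _ ≤ _ := h
      _ ≤ 4 * |y| ^ (3 : ℝ) := by
          rw [show (3 : ℝ) = ((3 : ℕ) : ℝ) by norm_num, Real.rpow_natCast, mul_comm]
          gcongr
          norm_num [Nat.factorial]
      _ ≤ 4 * |y| ^ (2 + s) := by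
          gcongr 4 * ?_
          exact Real.rpow_le_rpow_of_exponent_ge_of_imp (abs_nonneg y) hy (by linarith)
            (by intros; linarith)
  · have h1 : ‖Complex.exp (y * Complex.I)‖ = 1 := Complex.norm_exp_ofReal_mul_I y
    have h2 : ‖(y : ℂ) ^ 2 / 2‖ = |y| ^ 2 / 2 := by simp
    calc _ ≤ ‖Complex.exp (y * Complex.I)‖ + ‖(1 : ℂ)‖ + ‖(y : ℂ) * Complex.I‖ +
          ‖(y : ℂ) ^ 2 / 2‖ := by
            refine (norm_add_le _ _).trans ?_
            gcongr
            refine (norm_sub_le _ _).trans ?_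
            gcongr
            exact norm_sub_le _ _
      _ = 1 + 1 + |y| + |y| ^ 2 / 2 := by rw [h1, h2, hn, norm_one]
      _ ≤ 4 * |y| ^ (2 : ℝ) := by rw [Real.rpow_two]; nlinarith
      _ ≤ 4 * |y| ^ (2 + s) := by
          gcongr 4 * ?_
          exact Real.rpow_le_rpow_of_exponent_le hy.le (by linarith)

theorem abs_exp_neg_sub_le {s r : ℝ} (hs1 : s ≤ 1) (hr0 : 0 ≤ r) (hr1 : r ≤ 1) :
    |Real.exp (-r ^ 2 / 2) - (1 - r ^ 2 / 2)| ≤ r ^ (2 + s) := by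
  have hr2 : r ^ 2 ≤ 1 := pow_le_one₀ hr0 hr1
  have h := Real.abs_exp_sub_one_sub_id_le (x := -r ^ 2 / 2) (by
    rw [abs_le]; constructor <;> nlinarith)
  calc _ = |Real.exp (-r ^ 2 / 2) - 1 - -r ^ 2 / 2| := by congr 1; ring
    _ ≤ _ := h
    _ ≤ r ^ (3 : ℝ) := by
        rw [show (3 : ℝ) = ((3 : ℕ) : ℝ) by norm_num, Real.rpow_natCast]
        nlinarith [pow_nonneg hr0 3]
    _ ≤ r ^ (2 + s) := Real.rpow_le_rpow_of_exponent_ge_of_imp hr0 hr1 (by linarith)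
            (by intros; linarith)

namespace IsNormalisedDensity

variable {f : EuclideanSpace ℝ (Fin d) → ℝ} {s ρ : ℝ}

theorem aestronglyMeasurable_mul (h : IsNormalisedDensity f s ρ)
    {g : EuclideanSpace ℝ (Fin d) → ℝ} (hg : Continuous g) :
    AEStronglyMeasurable (fun x => g x * f x) volume :=
  hg.aestronglyMeasurable.mul h.integrable.aestronglyMeasurable

theorem integrable_mul_of_abs_le (h : IsNormalisedDensity f s ρ)
    {g : EuclideanSpace ℝ (Fin d) → ℝ} (hg : Continuous g) (C : ℝ)
    (hgC : ∀ x, |g x| ≤ C * (1 + ‖x‖ ^ (2 + s))) : Integrable fun x => g x * f x := by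
  have hi : Integrable fun x => C * (f x + ‖x‖ ^ (2 + s) * f x) :=
    (h.integrable.add h.integrable_moment).const_mul C
  refine hi.mono' (h.aestronglyMeasurable_mul hg) (Filter.Eventually.of_forall fun x => ?_)
  rw [norm_mul, Real.norm_of_nonneg (h.nonneg x), Real.norm_eq_abs]
  have := mul_le_mul_of_nonneg_right (hgC x) (h.nonneg x)
  linarith

theorem sq_le_one_add_rpow (hs0 : 0 < s) {r : ℝ} (hr : 0 ≤ r) : r ^ 2 ≤ 1 + r ^ (2 + s) := by
  rcases le_or_gt r 1 with h | h
  · have : r ^ 2 ≤ 1 := pow_le_one₀ hr h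
    have : 0 ≤ r ^ (2 + s) := by positivity
    linarith
  · have : r ^ (2 : ℝ) ≤ r ^ (2 + s) := Real.rpow_le_rpow_of_exponent_le h.le (by linarith)
    rw [Real.rpow_two] at this
    linarith

theorem integrable_norm_sq (h : IsNormalisedDensity f s ρ) (hs0 : 0 < s) :
    Integrable fun x => ‖x‖ ^ 2 * f x :=
  h.integrable_mul_of_abs_le (by fun_prop) 1 fun x => by
    rw [abs_of_nonneg (by positivity), one_mul]
    exact sq_le_one_add_rpow hs0 (norm_nonneg x)

theorem integrable_coord_mul_coord (h : IsNormalisedDensity f s ρ) (hs0 : 0 < s) (i j : Fin d) :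
    Integrable fun x : EuclideanSpace ℝ (Fin d) => x i * x j * f x :=
  h.integrable_mul_of_abs_le (by fun_prop) 1 fun x => by
    rw [abs_mul, one_mul]
    refine le_trans ?_ (sq_le_one_add_rpow hs0 (norm_nonneg x))
    have h1 : |x i| ≤ ‖x‖ := by simpa using PiLp.norm_apply_le x i
    have h2 : |x j| ≤ ‖x‖ := by simpa using PiLp.norm_apply_le x j
    rw [sq]
    gcongr

theorem integral_inner_sq (h : IsNormalisedDensity f s ρ) (hs0 : 0 < s)
    (u : EuclideanSpace ℝ (Fin d)) : ∫ x, ⟪x, u⟫ ^ 2 * f x = ‖u‖ ^ 2 := by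
  have h1 : ∀ x : EuclideanSpace ℝ (Fin d),
      ⟪x, u⟫ ^ 2 * f x = ∑ i, ∑ j, u i * u j * (x i * x j * f x) := by
    intro x
    rw [PiLp.inner_apply, sq, Finset.sum_mul_sum, Finset.sum_mul]
    refine Finset.sum_congr rfl fun i _ => ?_
    rw [Finset.sum_mul]
    refine Finset.sum_congr rfl fun j _ => ?_
    simp
    ring
  simp only [h1]
  have hi : ∀ i j, Integrable fun x : EuclideanSpace ℝ (Fin d) => u i * u j * (x i * x j * f x) :=
    fun i j => (h.integrable_coord_mul_coord hs0 i j).const_mul _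
  rw [integral_finsetSum _ fun i _ => integrable_finsetSum _ fun j _ => hi i j]
  simp only [integral_finsetSum _ fun j _ => hi _ j, integral_const_mul, h.covariance]
  rw [EuclideanSpace.norm_sq_eq]
  simp [sq]

theorem integral_norm_sq (h : IsNormalisedDensity f s ρ) (hs0 : 0 < s) :
    ∫ x, ‖x‖ ^ 2 * f x = d := by
  have h1 : ∀ x : EuclideanSpace ℝ (Fin d), ‖x‖ ^ 2 * f x = ∑ i, x i * x i * f x := by
    intro x
    rw [EuclideanSpace.norm_sq_eq, Finset.sum_mul]
    simp [sq]
  simp only [h1]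
  rw [integral_finsetSum _ fun i _ => h.integrable_coord_mul_coord hs0 i i]
  simp [h.covariance]

theorem integrable_smul (h : IsNormalisedDensity f s ρ) (hs0 : 0 < s) :
    Integrable fun x => f x • x := by
  have h1 : Integrable fun x => ‖x‖ * f x :=
    h.integrable_mul_of_abs_le (by fun_prop) 2 fun x => by
      rw [abs_of_nonneg (norm_nonneg x)]
      have := sq_le_one_add_rpow hs0 (norm_nonneg x)
      have : 0 ≤ ‖x‖ ^ (2 + s) := by positivity
      nlinarith [sq_nonneg (‖x‖ - 1)]
  refine h1.mono' (h.integrable.aestronglyMeasurable.smul aestronglyMeasurable_id)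
    (Filter.Eventually.of_forall fun x => ?_)
  rw [norm_smul, Real.norm_of_nonneg (h.nonneg x), mul_comm]

theorem integral_inner (h : IsNormalisedDensity f s ρ) (hs0 : 0 < s)
    (u : EuclideanSpace ℝ (Fin d)) : ∫ x, ⟪x, u⟫ * f x = 0 := by
  have h1 := _root_.integral_inner (𝕜 := ℝ) (h.integrable_smul hs0) u
  rw [h.mean, inner_zero_right] at h1
  rw [← h1]
  congr with x
  rw [inner_smul_right, real_inner_comm, mul_comm]

theorem integrable_inner (h : IsNormalisedDensity f s ρ) (hs0 : 0 < s)
    (u : EuclideanSpace ℝ (Fin d)) : Integrable fun x => ⟪x, u⟫ * f x := by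
  refine ((h.integrable_smul hs0).const_inner u).congr (Filter.Eventually.of_forall fun x => ?_)
  simp only
  rw [inner_smul_right, real_inner_comm, mul_comm]

theorem integrable_inner_sq (h : IsNormalisedDensity f s ρ) (hs0 : 0 < s)
    (u : EuclideanSpace ℝ (Fin d)) : Integrable fun x => ⟪x, u⟫ ^ 2 * f x :=
  h.integrable_mul_of_abs_le (by fun_prop) (‖u‖ ^ 2) fun x => by
    rw [abs_pow]
    calc |⟪x, u⟫| ^ 2 ≤ (‖x‖ * ‖u‖) ^ 2 := by gcongr; exact abs_real_inner_le_norm x u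
      _ = ‖u‖ ^ 2 * ‖x‖ ^ 2 := by ring
      _ ≤ _ := by gcongr; exact sq_le_one_add_rpow hs0 (norm_nonneg x)

/-- Integrate the scalar bound at `y = ⟪x, u⟫`: centring removes the linear term, and the identity
covariance makes the quadratic term `‖u‖² / 2`. -/
theorem norm_charFn_sub_taylor_le (h : IsNormalisedDensity f s ρ) (hs0 : 0 < s) (hs1 : s ≤ 1)
    (u : EuclideanSpace ℝ (Fin d)) :
    ‖charFn f u - ((1 - ‖u‖ ^ 2 / 2 : ℝ) : ℂ)‖ ≤ 4 * ρ * ‖u‖ ^ (2 + s) := by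
  have hi0 : Integrable fun x => ((f x : ℝ) : ℂ) := h.integrable.ofReal
  have hi1 : Integrable fun x => ((⟪x, u⟫ * f x : ℝ) : ℂ) := (h.integrable_inner hs0 u).ofReal
  have hi2 : Integrable fun x => ((⟪x, u⟫ ^ 2 * f x : ℝ) : ℂ) :=
    (h.integrable_inner_sq hs0 u).ofReal
  have hie := integrable_cexp_inner_mul_ofReal h.integrable u
  have e0 : ∫ x, ((f x : ℝ) : ℂ) = 1 := by
    rw [integral_complex_ofReal, h.integral_eq_one, Complex.ofReal_one]
  have e1 : ∫ x, ((⟪x, u⟫ * f x : ℝ) : ℂ) = 0 := by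
    rw [integral_complex_ofReal, h.integral_inner hs0, Complex.ofReal_zero]
  have e2 : ∫ x, ((⟪x, u⟫ ^ 2 * f x : ℝ) : ℂ) = (‖u‖ ^ 2 : ℝ) := by
    rw [integral_complex_ofReal, h.integral_inner_sq hs0]
  have key : charFn f u - ((1 - ‖u‖ ^ 2 / 2 : ℝ) : ℂ) =
      ∫ x, (Complex.exp (⟪x, u⟫ * Complex.I) - 1 - ⟪x, u⟫ * Complex.I +
        (⟪x, u⟫ : ℂ) ^ 2 / 2) * f x := by
    have h1 : ∀ x : EuclideanSpace ℝ (Fin d),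
        (Complex.exp (⟪x, u⟫ * Complex.I) - 1 - ⟪x, u⟫ * Complex.I +
        (⟪x, u⟫ : ℂ) ^ 2 / 2) * f x = Complex.exp (⟪x, u⟫ * Complex.I) * f x - ((f x : ℝ) : ℂ) -
        Complex.I * ((⟪x, u⟫ * f x : ℝ) : ℂ) + (1 / 2 : ℂ) * ((⟪x, u⟫ ^ 2 * f x : ℝ) : ℂ) := by
      intro x; push_cast; ring
    simp only [h1]
    have hi3 : Integrable fun x => Complex.exp (⟪x, u⟫ * Complex.I) * f x - ((f x : ℝ) : ℂ) :=
      hie.sub hi0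
    have hi4 : Integrable fun x => Complex.exp (⟪x, u⟫ * Complex.I) * f x - ((f x : ℝ) : ℂ) -
        Complex.I * ((⟪x, u⟫ * f x : ℝ) : ℂ) := hi3.sub (hi1.const_mul _)
    rw [integral_add hi4 (hi2.const_mul _), integral_sub hi3 (hi1.const_mul _), integral_sub hie hi0, integral_const_mul,
      integral_const_mul, e0, e1, e2, charFn]
    push_cast
    ring
  rw [key]
  refine (norm_integral_le_of_norm_le ((h.integrable_moment.const_mul (4 * ‖u‖ ^ (2 + s))))
    (Filter.Eventually.of_forall fun x => ?_)).trans_eq ?_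
  · rw [norm_mul, Complex.norm_real, Real.norm_of_nonneg (h.nonneg x)]
    calc _ ≤ 4 * |⟪x, u⟫| ^ (2 + s) * f x :=
          mul_le_mul_of_nonneg_right (norm_exp_mul_I_sub_taylor_le hs0 hs1 _) (h.nonneg x)
      _ ≤ 4 * (‖x‖ * ‖u‖) ^ (2 + s) * f x := by
          have := h.nonneg x
          gcongr
          exact abs_real_inner_le_norm x u
      _ = _ := by rw [Real.mul_rpow (norm_nonneg _) (norm_nonneg _)]; ring
  · rw [integral_const_mul, h.moment]; ring

theorem norm_charFn_sub_exp_le (h : IsNormalisedDensity f s ρ) (hs0 : 0 < s) (hs1 : s ≤ 1)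
    {u : EuclideanSpace ℝ (Fin d)} (hu : ‖u‖ ≤ 1) :
    ‖charFn f u - (Real.exp (-‖u‖ ^ 2 / 2) : ℝ)‖ ≤ (4 * ρ + 1) * ‖u‖ ^ (2 + s) := by
  have h1 := h.norm_charFn_sub_taylor_le hs0 hs1 u
  have h2 := abs_exp_neg_sub_le hs1 (norm_nonneg u) hu
  rw [← Real.norm_eq_abs, ← Complex.norm_real, Complex.ofReal_sub] at h2
  calc _ = ‖(charFn f u - ((1 - ‖u‖ ^ 2 / 2 : ℝ) : ℂ)) -
        ((Real.exp (-‖u‖ ^ 2 / 2) : ℝ) - ((1 - ‖u‖ ^ 2 / 2 : ℝ) : ℂ))‖ := by congr 1; ring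
    _ ≤ _ := norm_sub_le _ _
    _ ≤ _ := add_le_add h1 h2
    _ = _ := by ring

end IsNormalisedDensity

/-! ### Comparing the product with the Gaussian pointwise. -/

/-- Telescoping, one factor exchanged at a time. The weights `M i` keep the decay of the whole
product; plain bounds by `1` would lose it. -/
theorem norm_prod_sub_prod_le {ι : Type*} (S : Finset ι) (x y : ι → ℂ) (M : ι → ℝ)
    (hM : ∀ i ∈ S, 0 < M i) (hx : ∀ i ∈ S, ‖x i‖ ≤ M i) (hy : ∀ i ∈ S, ‖y i‖ ≤ M i) :
    ‖∏ i ∈ S, x i - ∏ i ∈ S, y i‖ ≤ (∏ i ∈ S, M i) * ∑ i ∈ S, ‖x i - y i‖ / M i := by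
  classical
  induction S using Finset.induction_on with
  | empty => simp
  | insert j S hj ih =>
    have hS : ∀ i ∈ S, i ∈ insert j S := fun i hi => Finset.mem_insert_of_mem hi
    have hjS := Finset.mem_insert_self j S
    have ih' := ih (fun i hi => hM i (hS i hi)) (fun i hi => hx i (hS i hi))
      (fun i hi => hy i (hS i hi))
    rw [Finset.prod_insert hj, Finset.prod_insert hj, Finset.prod_insert hj, Finset.sum_insert hj]
    have hMj := hM j hjS
    have hP : ‖∏ i ∈ S, x i‖ ≤ ∏ i ∈ S, M i := by
      rw [norm_prod]
      exact Finset.prod_le_prod (fun i _ => norm_nonneg _) fun i hi => hx i (hS i hi)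
    calc ‖x j * ∏ i ∈ S, x i - y j * ∏ i ∈ S, y i‖
        = ‖(x j - y j) * ∏ i ∈ S, x i + y j * (∏ i ∈ S, x i - ∏ i ∈ S, y i)‖ := by
          congr 1; ring
      _ ≤ ‖x j - y j‖ * ∏ i ∈ S, M i +
          M j * ((∏ i ∈ S, M i) * ∑ i ∈ S, ‖x i - y i‖ / M i) := by
          refine (norm_add_le _ _).trans ?_
          rw [norm_mul, norm_mul]
          gcongr
          exact hy j hjS
      _ = _ := by field_simp

/-- Each factor is at most the largest one. This reduces a product of different dilates of `φ` to
the `N`-th powers whose integrals are known. -/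
theorem prod_le_sum_pow_card {ι : Type*} {S : Finset ι} (hS : S.Nonempty) (x : ι → ℝ)
    (hx : ∀ i, 0 ≤ x i) : ∏ i ∈ S, x i ≤ ∑ i ∈ S, x i ^ S.card := by
  obtain ⟨j, hj, hmax⟩ := Finset.exists_max_image S x hS
  calc ∏ i ∈ S, x i ≤ ∏ _i ∈ S, x j := Finset.prod_le_prod (fun i _ => hx i) hmax
    _ = x j ^ S.card := Finset.prod_const _
    _ ≤ _ := Finset.single_le_sum (f := fun i => x i ^ S.card) (fun i _ => pow_nonneg (hx i) _) hj

theorem prod_exp_sq_mul {S : Finset ℕ} {a : ℕ → ℝ} (ha : ∑ i ∈ S, a i ^ 2 = 1) (b r : ℝ) :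
    ∏ i ∈ S, Real.exp (-b * (a i * r) ^ 2) = Real.exp (-b * r ^ 2) := by
  rw [← Real.exp_sum, ← Finset.mul_sum]
  simp only [mul_pow]
  rw [← Finset.sum_mul, ha, one_mul]

section Product

variable {φ : EuclideanSpace ℝ (Fin d) → ℂ} {a : ℕ → ℝ} {c : ℝ}

/-- The central range: all the arguments lie in the unit ball. -/
theorem norm_prod_sub_exp_le_of_le_one {S : Finset ℕ} (hc0 : 0 ≤ c) (hc : c ≤ 1 / 2)
    (hφ : ∀ u, ‖φ u‖ ≤ Real.exp (-c * min 1 (‖u‖ ^ 2))) {D s : ℝ} (hD : 0 ≤ D) (hs : 0 < s)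
    (hφD : ∀ u, ‖u‖ ≤ 1 → ‖φ u - (Real.exp (-‖u‖ ^ 2 / 2) : ℝ)‖ ≤ D * ‖u‖ ^ (2 + s))
    {b : ℝ} (ha0 : ∀ i ∈ S, 0 ≤ a i) (hab : ∀ i ∈ S, a i ≤ b) (ha : ∑ i ∈ S, a i ^ 2 = 1)
    {t : EuclideanSpace ℝ (Fin d)} (hat : ∀ i ∈ S, a i * ‖t‖ ≤ 1) :
    ‖∏ i ∈ S, φ (a i • t) - (Real.exp (-‖t‖ ^ 2 / 2) : ℝ)‖ ≤
      D * Real.exp c * b ^ s * (‖t‖ ^ (2 + s) * Real.exp (-c * ‖t‖ ^ 2)) := by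
  have hsq : ∀ i ∈ S, (a i * ‖t‖) ^ 2 ≤ 1 := fun i hi =>
    pow_le_one₀ (mul_nonneg (ha0 i hi) (norm_nonneg t)) (hat i hi)
  have hx : ∀ i ∈ S, ‖φ (a i • t)‖ ≤ Real.exp (-c * (a i * ‖t‖) ^ 2) := fun i hi => by
    have := hφ (a i • t)
    rwa [norm_smul_of_nonneg (ha0 i hi), min_eq_right (hsq i hi)] at this
  have hy : ∀ i ∈ S, ‖((Real.exp (-(1 / 2) * (a i * ‖t‖) ^ 2) : ℝ) : ℂ)‖ ≤
      Real.exp (-c * (a i * ‖t‖) ^ 2) := fun i hi => by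
    rw [Complex.norm_real, Real.norm_of_nonneg (Real.exp_pos _).le]
    gcongr
  have hprod : ((Real.exp (-‖t‖ ^ 2 / 2) : ℝ) : ℂ) =
      ∏ i ∈ S, ((Real.exp (-(1 / 2) * (a i * ‖t‖) ^ 2) : ℝ) : ℂ) := by
    rw [← Complex.ofReal_prod, prod_exp_sq_mul ha]
    congr 2
    ring
  have hterm : ∀ i ∈ S, ‖φ (a i • t) - ((Real.exp (-(1 / 2) * (a i * ‖t‖) ^ 2) : ℝ) : ℂ)‖ /
      Real.exp (-c * (a i * ‖t‖) ^ 2) ≤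
      D * Real.exp c * b ^ s * ‖t‖ ^ (2 + s) * a i ^ 2 := by
    intro i hi
    have h1 := hφD (a i • t) (by rw [norm_smul_of_nonneg (ha0 i hi)]; exact hat i hi)
    rw [norm_smul_of_nonneg (ha0 i hi),
      show -(a i * ‖t‖) ^ 2 / 2 = -(1 / 2) * (a i * ‖t‖) ^ 2 by ring,
      Real.mul_rpow (ha0 i hi) (norm_nonneg t)] at h1
    -- Source of the rate: since `∑ a i ^ 2 = 1`, the errors add up to a multiple of `b ^ s`, with
    -- `b` of order `1/√n`.
    have h2 : a i ^ (2 + s) ≤ b ^ s * a i ^ 2 := by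
      rw [Real.rpow_add' (ha0 i hi) (by positivity), Real.rpow_two, mul_comm]
      gcongr
      · exact ha0 i hi
      · exact hab i hi
    have h3 : Real.exp (-c) ≤ Real.exp (-c * (a i * ‖t‖) ^ 2) := by
      gcongr
      nlinarith [hsq i hi]
    rw [div_le_iff₀ (Real.exp_pos _)]
    have hb : 0 ≤ b := (ha0 i hi).trans (hab i hi)
    have hai := ha0 i hi
    calc _ ≤ D * (a i ^ (2 + s) * ‖t‖ ^ (2 + s)) := h1
      _ ≤ D * (b ^ s * a i ^ 2 * ‖t‖ ^ (2 + s)) * (Real.exp c * Real.exp (-c)) := by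
          rw [← Real.exp_add, add_neg_cancel, Real.exp_zero, mul_one]
          gcongr
      _ ≤ D * (b ^ s * a i ^ 2 * ‖t‖ ^ (2 + s)) *
          (Real.exp c * Real.exp (-c * (a i * ‖t‖) ^ 2)) := by gcongr
      _ = _ := by ring
  rw [hprod]
  refine (norm_prod_sub_prod_le S _ _ _ (fun i _ => Real.exp_pos _) hx hy).trans ?_
  rw [prod_exp_sq_mul ha]
  calc _ ≤ Real.exp (-c * ‖t‖ ^ 2) *
        ∑ i ∈ S, D * Real.exp c * b ^ s * ‖t‖ ^ (2 + s) * a i ^ 2 := by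
        gcongr with i hi
        exact hterm i hi
    _ = _ := by rw [← Finset.mul_sum, ha]; ring

/-- The tail range: all the arguments stay away from the origin. -/
theorem norm_prod_le_of_le {N n : ℕ} (hN : 1 ≤ N) (hn : N ≤ n) (hc0 : 0 ≤ c)
    (hφ : ∀ u, ‖φ u‖ ≤ Real.exp (-c * min 1 (‖u‖ ^ 2))) {β : ℝ} (hβ0 : 0 ≤ β) (hβ1 : β ≤ 1)
    {t : EuclideanSpace ℝ (Fin d)} (hat : ∀ i ∈ Finset.Icc 1 n, β ≤ ‖a i • t‖) :
    ‖∏ i ∈ Finset.Icc 1 n, φ (a i • t)‖ ≤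
      Real.exp (-(c * β ^ 2) * (n - N)) * ∑ i ∈ Finset.Icc 1 N, ‖φ (a i • t)‖ ^ N := by
  -- The first `N` factors are kept for integrability in `t`; each of the others contributes a fixed
  -- factor below one when `c` and `β` are positive.
  have hsplit : Finset.Icc 1 n = Finset.Icc 1 N ∪ Finset.Ioc N n := by
    ext i; simp only [Finset.mem_union, Finset.mem_Icc, Finset.mem_Ioc]; omega
  have hdisj : Disjoint (Finset.Icc 1 N) (Finset.Ioc N n) := by
    rw [Finset.disjoint_left]
    intro i; simp only [Finset.mem_Icc, Finset.mem_Ioc]; omega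
  rw [norm_prod, hsplit, Finset.prod_union hdisj, mul_comm]
  have h1 := prod_le_sum_pow_card (S := Finset.Icc 1 N) (Finset.nonempty_Icc.2 hN)
    (fun i => ‖φ (a i • t)‖) fun i => norm_nonneg _
  rw [Nat.card_Icc, Nat.add_sub_cancel] at h1
  have h2 : ∏ i ∈ Finset.Ioc N n, ‖φ (a i • t)‖ ≤ Real.exp (-(c * β ^ 2) * (n - N)) := by
    calc _ ≤ ∏ _i ∈ Finset.Ioc N n, Real.exp (-(c * β ^ 2)) := by
          refine Finset.prod_le_prod (fun i _ => norm_nonneg _) fun i hi => (hφ _).trans ?_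
          have h3 := hat i (by rw [hsplit]; exact Finset.mem_union_right _ hi)
          have h4 : β ^ 2 ≤ min 1 (‖a i • t‖ ^ 2) :=
            le_min (pow_le_one₀ hβ0 hβ1) (pow_le_pow_left₀ hβ0 h3 2)
          gcongr
          nlinarith
      _ = _ := by
          rw [Finset.prod_const, Nat.card_Ioc, ← Real.exp_nat_mul, Nat.cast_sub hn, mul_comm]
  exact mul_le_mul h2 h1 (Finset.prod_nonneg fun i _ => norm_nonneg _) (Real.exp_pos _).le

/-- Either all arguments lie in the unit ball, or one does not. In the second case `‖t‖ ≥ √n / Λ`,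
so by comparability every argument has norm at least `Λ⁻²`. Adding the bounds of both cases avoids
splitting the integral over `t`. -/
theorem norm_prod_sub_exp_le {N n : ℕ} (hN : 1 ≤ N) (hn : N ≤ n) (hc0 : 0 ≤ c) (hc : c ≤ 1 / 2)
    (hφ : ∀ u, ‖φ u‖ ≤ Real.exp (-c * min 1 (‖u‖ ^ 2))) {D s : ℝ} (hD : 0 ≤ D) (hs : 0 < s)
    (hs1 : s ≤ 1)
    (hφD : ∀ u, ‖u‖ ≤ 1 → ‖φ u - (Real.exp (-‖u‖ ^ 2 / 2) : ℝ)‖ ≤ D * ‖u‖ ^ (2 + s))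
    {Λ : ℝ} (hΛ : 1 ≤ Λ) (hal : ∀ i ∈ Finset.Icc 1 n, (Λ * Real.sqrt n)⁻¹ ≤ a i)
    (hau : ∀ i ∈ Finset.Icc 1 n, a i ≤ Λ / Real.sqrt n)
    (ha : ∑ i ∈ Finset.Icc 1 n, a i ^ 2 = 1) (t : EuclideanSpace ℝ (Fin d)) :
    ‖∏ i ∈ Finset.Icc 1 n, φ (a i • t) - (Real.exp (-‖t‖ ^ 2 / 2) : ℝ)‖ ≤
      D * Real.exp c * (Λ / Real.sqrt n) ^ s * ((1 + ‖t‖ ^ 3) * Real.exp (-c * ‖t‖ ^ 2)) +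
      (Real.exp (-(c * (Λ⁻¹ ^ 2) ^ 2) * (n - N)) * ∑ i ∈ Finset.Icc 1 N, ‖φ (a i • t)‖ ^ N +
      Real.exp (-(1 / (4 * Λ ^ 2)) * n) * Real.exp (-(1 / 4) * ‖t‖ ^ 2)) := by
  have hn0 : (0 : ℝ) < n := by exact_mod_cast hN.trans hn
  have hsn : 0 < Real.sqrt n := Real.sqrt_pos.2 hn0
  have hΛ0 : 0 < Λ := by linarith
  have ha0 : ∀ i ∈ Finset.Icc 1 n, 0 ≤ a i := fun i hi => le_trans (by positivity) (hal i hi)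
  by_cases hat : ∀ i ∈ Finset.Icc 1 n, a i * ‖t‖ ≤ 1
  · refine le_add_of_le_of_nonneg ?_ (by positivity)
    refine (norm_prod_sub_exp_le_of_le_one hc0 hc hφ hD hs hφD ha0 hau ha hat).trans ?_
    -- This removes `s` from the integrand, so the final constant is uniform in `s`.
    have hr : ‖t‖ ^ (2 + s) ≤ 1 + ‖t‖ ^ 3 := by
      have h3 : ‖t‖ ^ 3 = ‖t‖ ^ (3 : ℝ) := by
        rw [show (3 : ℝ) = ((3 : ℕ) : ℝ) by norm_num, Real.rpow_natCast]
      rcases le_or_gt ‖t‖ 1 with h | h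
      · exact (Real.rpow_le_one (norm_nonneg t) h (by linarith)).trans
          (le_add_of_nonneg_right (by positivity))
      · rw [h3]
        exact (Real.rpow_le_rpow_of_exponent_le h.le (by linarith)).trans
          (le_add_of_nonneg_left zero_le_one)
    gcongr
  · push Not at hat
    obtain ⟨j, hj, hjt⟩ := hat
    have ht : Real.sqrt n / Λ ≤ ‖t‖ := by
      have h1 : 1 < Λ / Real.sqrt n * ‖t‖ :=
        hjt.trans_le (mul_le_mul_of_nonneg_right (hau j hj) (norm_nonneg t))
      rw [div_mul_eq_mul_div, one_lt_div hsn] at h1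
      rw [div_le_iff₀ hΛ0]
      linarith
    have hβ : ∀ i ∈ Finset.Icc 1 n, Λ⁻¹ ^ 2 ≤ ‖a i • t‖ := by
      intro i hi
      rw [norm_smul_of_nonneg (ha0 i hi)]
      calc Λ⁻¹ ^ 2 = (Λ * Real.sqrt n)⁻¹ * (Real.sqrt n / Λ) := by field_simp
        _ ≤ _ := mul_le_mul (hal i hi) ht (by positivity) (ha0 i hi)
    have htail := norm_prod_le_of_le hN hn hc0 hφ (by positivity)
      (pow_le_one₀ (by positivity) (inv_le_one_of_one_le₀ hΛ)) hβ
    refine le_add_of_nonneg_of_le (by positivity) ((norm_sub_le _ _).trans ?_)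
    refine add_le_add htail ?_
    rw [Complex.norm_real, Real.norm_of_nonneg (Real.exp_pos _).le, ← Real.exp_add]
    gcongr
    -- Half of the Gaussian exponent is spent on decay in `n`; the other half stays for
    -- integrability in `t`.
    have h2 : (Real.sqrt n / Λ) ^ 2 ≤ ‖t‖ ^ 2 := by gcongr
    rw [div_pow, Real.sq_sqrt hn0.le] at h2
    have h3 : 1 / (4 * Λ ^ 2) * n = n / Λ ^ 2 / 4 := by field_simp
    linarith

end Product

/-! ### Integrating the pointwise bound. -/

/-- Undoing a dilation by `a i` in the tail integral costs up to `(Λ√n)^d`; the exponential decay in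
`n` absorbs this power and still leaves `n^(-s/2)`. -/
theorem sqrt_pow_mul_exp_neg_le (k : ℕ) {α : ℝ} (hα : 0 < α) {n : ℕ} (hn : 1 ≤ n) {s : ℝ}
    (hs : s ≤ 1) :
    Real.sqrt n ^ k * Real.exp (-α * n) ≤
      (k + 1).factorial / α ^ (k + 1) * (1 / (n : ℝ) ^ (s / 2)) := by
  have hn1 : (1 : ℝ) ≤ n := by exact_mod_cast hn
  have hn0 : (0 : ℝ) < n := by linarith
  have h1 := Real.pow_div_factorial_le_exp (x := α * n) (by positivity) (k + 1)
  have h2 : (n : ℝ) ^ (s / 2) ≤ Real.sqrt n := by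
    rw [Real.sqrt_eq_rpow]
    exact Real.rpow_le_rpow_of_exponent_le hn1 (by linarith)
  have h3 : Real.sqrt n ≤ n := by
    rw [Real.sqrt_le_left hn0.le]
    nlinarith
  have h4 : Real.sqrt n ^ k * (n : ℝ) ^ (s / 2) ≤ (n : ℝ) ^ (k + 1) := by
    rw [pow_succ]
    gcongr
    exact h2.trans h3
  rw [neg_mul, Real.exp_neg, mul_one_div, le_div_iff₀ (by positivity), mul_right_comm,
    ← div_eq_mul_inv, div_le_iff₀ (Real.exp_pos _)]
  calc _ ≤ (n : ℝ) ^ (k + 1) := h4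
    _ = (k + 1).factorial / α ^ (k + 1) * ((α * n) ^ (k + 1) / (k + 1).factorial) := by
        rw [mul_pow]
        have : ((k + 1).factorial : ℝ) ≠ 0 := by positivity
        field_simp
    _ ≤ _ := by gcongr

theorem integrable_one_add_norm_pow_mul_exp {c : ℝ} (hc : 0 < c) :
    Integrable fun t : EuclideanSpace ℝ (Fin d) => (1 + ‖t‖ ^ 3) * Real.exp (-c * ‖t‖ ^ 2) := by
  have h := (integrable_exp_neg_mul_sq_norm (d := d) (b := c / 2) (by positivity)).const_mul
    (1 + 2 / (c / 2) ^ 2 + 1)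
  refine h.mono' (Continuous.aestronglyMeasurable (by fun_prop))
    (Filter.Eventually.of_forall fun t => ?_)
  rw [Real.norm_of_nonneg (by positivity)]
  have h1 := Real.pow_div_factorial_le_exp (x := c / 2 * ‖t‖ ^ 2) (by positivity) 2
  have h2 : ‖t‖ ^ 3 ≤ 1 + ‖t‖ ^ 4 := by
    nlinarith [sq_nonneg (‖t‖ ^ 2 - ‖t‖), sq_nonneg (‖t‖ - 1), sq_nonneg ‖t‖,
      sq_nonneg (‖t‖ ^ 2 - 1)]
  have h3 : ‖t‖ ^ 4 ≤ 2 / (c / 2) ^ 2 * Real.exp (c / 2 * ‖t‖ ^ 2) := by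
    calc ‖t‖ ^ 4 = 2 / (c / 2) ^ 2 * ((c / 2 * ‖t‖ ^ 2) ^ 2 / (2 : ℕ).factorial) := by
          simp only [Nat.factorial]; push_cast; field_simp
      _ ≤ _ := by gcongr
  have h4 : 1 ≤ Real.exp (c / 2 * ‖t‖ ^ 2) := Real.one_le_exp (by positivity)
  have h5 : Real.exp (-c * ‖t‖ ^ 2) = Real.exp (-(c / 2) * ‖t‖ ^ 2) *
      (Real.exp (c / 2 * ‖t‖ ^ 2))⁻¹ := by
    rw [← Real.exp_neg, ← Real.exp_add]; congr 1; ring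
  rw [h5, mul_left_comm, mul_comm (_ + 1)]
  gcongr
  rw [← div_eq_mul_inv, div_le_iff₀ (Real.exp_pos _)]
  linarith

/-- `L¹` closeness to the Gaussian of a product of dilated characteristic functions. -/
theorem exists_integral_norm_prod_sub_exp_le (d : ℕ) {N : ℕ} (hN : 1 ≤ N) {c D Λ B : ℝ}
    (hc0 : 0 < c) (hc : c ≤ 1 / 2) (hD : 0 ≤ D) (hΛ : 1 ≤ Λ) (hB : 0 ≤ B) :
    ∃ C : ℝ, 0 < C ∧ ∀ φ : EuclideanSpace ℝ (Fin d) → ℂ, Continuous φ →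
      (∀ u, ‖φ u‖ ≤ Real.exp (-c * min 1 (‖u‖ ^ 2))) →
      Integrable (fun u => ‖φ u‖ ^ N) → ∫ u, ‖φ u‖ ^ N ≤ B →
      ∀ s : ℝ, 0 < s → s ≤ 1 →
      (∀ u, ‖u‖ ≤ 1 → ‖φ u - (Real.exp (-‖u‖ ^ 2 / 2) : ℝ)‖ ≤ D * ‖u‖ ^ (2 + s)) →
      ∀ (n : ℕ) (a : ℕ → ℝ), N ≤ n → (∀ i ∈ Finset.Icc 1 n, (Λ * Real.sqrt n)⁻¹ ≤ a i) →
      (∀ i ∈ Finset.Icc 1 n, a i ≤ Λ / Real.sqrt n) → ∑ i ∈ Finset.Icc 1 n, a i ^ 2 = 1 →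
      Integrable (fun t => ∏ i ∈ Finset.Icc 1 n, φ (a i • t) -
        ((Real.exp (-‖t‖ ^ 2 / 2) : ℝ) : ℂ)) ∧
      ∫ t, ‖∏ i ∈ Finset.Icc 1 n, φ (a i • t) - ((Real.exp (-‖t‖ ^ 2 / 2) : ℝ) : ℂ)‖ ≤
        C / (n : ℝ) ^ (s / 2) := by
  have hΛ0 : 0 < Λ := by linarith
  set I₁ := ∫ t : EuclideanSpace ℝ (Fin d), (1 + ‖t‖ ^ 3) * Real.exp (-c * ‖t‖ ^ 2) with hI₁
  set I₂ := ∫ t : EuclideanSpace ℝ (Fin d), Real.exp (-(1 / 4) * ‖t‖ ^ 2) with hI₂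
  have hI₁0 : 0 ≤ I₁ := integral_nonneg fun t => by simp only [Pi.zero_apply]; positivity
  have hI₂0 : 0 ≤ I₂ := integral_nonneg fun t => by simp only [Pi.zero_apply]; positivity
  set α := c * (Λ⁻¹ ^ 2) ^ 2 with hα
  have hα0 : 0 < α := by positivity
  set β := 1 / (4 * Λ ^ 2) with hβ
  have hβ0 : 0 < β := by positivity
  -- The summands match the terms of `norm_prod_sub_exp_le`; the final `+ 1` only makes the constant
  -- positive.
  refine ⟨D * Real.exp c * Λ * I₁ + (Real.exp (α * N) * (N * (Λ ^ d * B)) *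
    ((d + 1).factorial / α ^ (d + 1)) + (0 + 1).factorial / β ^ (0 + 1) * I₂) + 1, by positivity,
    fun φ hφc hφ hφi hφB s hs hs1 hφD n a hn hal hau ha => ?_⟩
  have hn1 : 1 ≤ n := hN.trans hn
  have hn0 : (0 : ℝ) < n := by exact_mod_cast hn1
  have hsn : 0 < Real.sqrt n := Real.sqrt_pos.2 hn0
  have hpt := norm_prod_sub_exp_le hN hn hc0.le hc hφ hD hs hs1 hφD hΛ hal hau ha
  rw [← hα, ← hβ] at hpt
  have hpos : ∀ i ∈ Finset.Icc 1 N, 0 < a i := fun i hi =>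
    lt_of_lt_of_le (by positivity) (hal i (Finset.Icc_subset_Icc_right hn hi))
  have hφai : ∀ i ∈ Finset.Icc 1 N, Integrable fun t => ‖φ (a i • t)‖ ^ N := fun i hi =>
    hφi.comp_smul (hpos i hi).ne'
  have hφaB : ∀ i ∈ Finset.Icc 1 N, ∫ t, ‖φ (a i • t)‖ ^ N ≤ (Λ * Real.sqrt n) ^ d * B := by
    intro i hi
    rw [Measure.integral_comp_smul_of_nonneg volume (fun u => ‖φ u‖ ^ N) (a i)
      (hR := (hpos i hi).le), finrank_euclideanSpace_fin, smul_eq_mul, ← inv_pow]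
    have h1 := hal i (Finset.Icc_subset_Icc_right hn hi)
    have h2 : (a i)⁻¹ ≤ Λ * Real.sqrt n := inv_le_of_inv_le₀ (by positivity) h1
    have h3 : 0 ≤ (a i)⁻¹ := (inv_pos.2 (hpos i hi)).le
    have h4 : 0 ≤ ∫ u, ‖φ u‖ ^ N := integral_nonneg fun u => by
      simp only [Pi.zero_apply]; positivity
    gcongr
  have hi1 := (integrable_one_add_norm_pow_mul_exp (d := d) hc0).const_mul
    (D * Real.exp c * (Λ / Real.sqrt n) ^ s)
  have hi2 := (integrable_finsetSum (Finset.Icc 1 N) hφai).const_mul (Real.exp (-α * (n - N)))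
  have hi3 := (integrable_exp_neg_mul_sq_norm (d := d) (b := 1 / 4) (by norm_num)).const_mul
    (Real.exp (-β * n))
  have hbound := hi1.add (hi2.add hi3)
  have hcont : Continuous fun t => ∏ i ∈ Finset.Icc 1 n, φ (a i • t) -
      ((Real.exp (-‖t‖ ^ 2 / 2) : ℝ) : ℂ) := by fun_prop
  have hint := hbound.mono' hcont.aestronglyMeasurable (Filter.Eventually.of_forall hpt)
  refine ⟨hint, ?_⟩
  have hle := integral_mono hint.norm hbound hpt
  rw [integral_add' hi1 (hi2.add hi3), integral_add' hi2 hi3, integral_const_mul,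
    integral_const_mul, integral_const_mul, integral_finsetSum _ hφai, ← hI₁, ← hI₂] at hle
  refine hle.trans ?_
  have hns : 0 < (n : ℝ) ^ (s / 2) := by positivity
  have e1 : (Λ / Real.sqrt n) ^ s ≤ Λ * (1 / (n : ℝ) ^ (s / 2)) := by
    rw [Real.div_rpow hΛ0.le hsn.le, Real.sqrt_eq_rpow, ← Real.rpow_mul hn0.le,
      show 1 / 2 * s = s / 2 by ring, mul_one_div]
    gcongr
    exact (Real.rpow_le_rpow_of_exponent_le hΛ hs1).trans_eq (Real.rpow_one Λ)
  have e2 : Real.exp (-α * (n - N)) * ∑ i ∈ Finset.Icc 1 N, ∫ t, ‖φ (a i • t)‖ ^ N ≤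
      Real.exp (α * N) * (N * (Λ ^ d * B)) *
        ((d + 1).factorial / α ^ (d + 1) * (1 / (n : ℝ) ^ (s / 2))) := by
    have h1 := Finset.sum_le_sum hφaB
    rw [Finset.sum_const, Nat.card_Icc, Nat.add_sub_cancel, nsmul_eq_mul] at h1
    calc _ ≤ Real.exp (-α * (n - N)) * (N * ((Λ * Real.sqrt n) ^ d * B)) := by gcongr
      _ = Real.exp (α * N) * (N * (Λ ^ d * B)) * (Real.sqrt n ^ d * Real.exp (-α * n)) := by
          rw [show -α * ((n : ℝ) - N) = α * N + -α * n by ring, Real.exp_add, mul_pow]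
          ring
      _ ≤ _ :=
          mul_le_mul_of_nonneg_left (sqrt_pow_mul_exp_neg_le d hα0 hn1 hs1) (by positivity)
  have e3 := sqrt_pow_mul_exp_neg_le 0 hβ0 hn1 hs1
  rw [pow_zero, one_mul] at e3
  calc _ ≤ D * Real.exp c * (Λ * (1 / (n : ℝ) ^ (s / 2))) * I₁ +
        (Real.exp (α * N) * (N * (Λ ^ d * B)) *
        ((d + 1).factorial / α ^ (d + 1) * (1 / (n : ℝ) ^ (s / 2))) +
        ((0 + 1).factorial / β ^ (0 + 1) * (1 / (n : ℝ) ^ (s / 2))) * I₂) := by gcongr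
    _ ≤ _ + 1 / (n : ℝ) ^ (s / 2) := le_add_of_nonneg_right (by positivity)
    _ = _ := by ring

/-! ### The scales `σ i / (√n σ̄)` and the normalised density. -/

section Scales

variable {σ : ℕ → ℝ} {n : ℕ}

theorem sqrt_mul_quadMean_sq (hn : 1 ≤ n) (σ : ℕ → ℝ) :
    (Real.sqrt n * quadMean σ n) ^ 2 = ∑ i ∈ Finset.Icc 1 n, σ i ^ 2 := by
  have hn0 : (0 : ℝ) < n := by exact_mod_cast hn
  have h : 0 ≤ ∑ i ∈ Finset.Icc 1 n, σ i ^ 2 := Finset.sum_nonneg fun i _ => sq_nonneg _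
  rw [mul_pow, quadMean, Real.sq_sqrt hn0.le, Real.sq_sqrt (by positivity)]
  field_simp

theorem sqrt_mul_quadMean_pos (hn : 1 ≤ n) (hσ : ∀ i, 1 ≤ i → 0 < σ i) :
    0 < Real.sqrt n * quadMean σ n := by
  have h : 0 < (Real.sqrt n * quadMean σ n) ^ 2 := by
    rw [sqrt_mul_quadMean_sq hn]
    exact Finset.sum_pos (fun i hi => pow_pos (hσ i (Finset.mem_Icc.1 hi).1) 2)
      (Finset.nonempty_Icc.2 hn)
  have h0 : 0 ≤ Real.sqrt n * quadMean σ n := mul_nonneg (Real.sqrt_nonneg _) (Real.sqrt_nonneg _)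
  exact lt_of_le_of_ne h0 fun h1 => by simp [← h1] at h

theorem sqrt_mul_le_sqrt_mul_quadMean (hn : 1 ≤ n) (hσ : ∀ i, 1 ≤ i → 0 < σ i) {l : ℝ}
    (hl : 0 < l) (h : ∀ i ∈ Finset.Icc 1 n, l ≤ σ i) :
    Real.sqrt n * l ≤ Real.sqrt n * quadMean σ n := by
  refine (sq_le_sq₀ (by positivity) (sqrt_mul_quadMean_pos hn hσ).le).1 ?_
  rw [sqrt_mul_quadMean_sq hn, mul_pow, Real.sq_sqrt (by positivity)]
  have h1 : ∑ _i ∈ Finset.Icc 1 n, l ^ 2 ≤ ∑ i ∈ Finset.Icc 1 n, σ i ^ 2 :=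
    Finset.sum_le_sum fun i hi => pow_le_pow_left₀ hl.le (h i hi) 2
  simpa using h1

theorem sqrt_mul_quadMean_le_sqrt_mul (hn : 1 ≤ n) (hσ : ∀ i, 1 ≤ i → 0 < σ i) {L : ℝ}
    (hL : 0 < L) (h : ∀ i ∈ Finset.Icc 1 n, σ i ≤ L) :
    Real.sqrt n * quadMean σ n ≤ Real.sqrt n * L := by
  refine (sq_le_sq₀ (sqrt_mul_quadMean_pos hn hσ).le (by positivity)).1 ?_
  rw [sqrt_mul_quadMean_sq hn, mul_pow, Real.sq_sqrt (by positivity)]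
  have h1 : ∑ i ∈ Finset.Icc 1 n, σ i ^ 2 ≤ ∑ _i ∈ Finset.Icc 1 n, L ^ 2 :=
    Finset.sum_le_sum fun i hi =>
      pow_le_pow_left₀ (hσ i (Finset.mem_Icc.1 hi).1).le (h i hi) 2
  simpa using h1

theorem normalisedDensity_eq (f : EuclideanSpace ℝ (Fin d) → ℝ) (σ : ℕ → ℝ) (n : ℕ) :
    normalisedDensity f σ n = fun x => (Real.sqrt n * quadMean σ n) ^ d *
      convRescale f σ n ((Real.sqrt n * quadMean σ n) • x) := by
  have h0 : 0 ≤ Real.sqrt n * quadMean σ n := mul_nonneg (Real.sqrt_nonneg _) (Real.sqrt_nonneg _)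
  have h1 : (quadMean σ n ^ 2 * n) ^ ((d : ℝ) / 2) = (Real.sqrt n * quadMean σ n) ^ d := by
    have h2 : quadMean σ n ^ 2 * n = (Real.sqrt n * quadMean σ n) ^ (2 : ℝ) := by
      rw [Real.rpow_two, mul_pow, Real.sq_sqrt (by positivity)]; ring
    rw [h2, ← Real.rpow_mul h0, ← Real.rpow_natCast]
    congr 1
    ring
  unfold normalisedDensity
  rw [h1]

theorem integrable_normalisedDensity {f : EuclideanSpace ℝ (Fin d) → ℝ} (hf : Integrable f)
    (hσ : ∀ i, 1 ≤ i → 0 < σ i) (hn : 1 ≤ n) : Integrable (normalisedDensity f σ n) := by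
  rw [normalisedDensity_eq]
  exact ((integrable_convRescale hf hσ n).comp_smul (sqrt_mul_quadMean_pos hn hσ).ne').const_mul _

theorem charFn_normalisedDensity {f : EuclideanSpace ℝ (Fin d) → ℝ} (hf : Integrable f)
    (hσ : ∀ i, 1 ≤ i → 0 < σ i) (hn : 1 ≤ n) (t : EuclideanSpace ℝ (Fin d)) :
    charFn (normalisedDensity f σ n) t =
      ∏ i ∈ Finset.Icc 1 n, charFn f ((σ i / (Real.sqrt n * quadMean σ n)) • t) := by
  rw [normalisedDensity_eq, charFn_const_mul_comp_smul _ (sqrt_mul_quadMean_pos hn hσ),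
    charFn_convRescale hf hσ _ n hn]
  simp only [smul_smul, div_eq_mul_inv]

end Scales

/-! ### Return to densities and conclusion. -/

theorem memLp_top_and_eLpNorm_sub_gaussian_le {h : EuclideanSpace ℝ (Fin d) → ℝ}
    (hh : Integrable h)
    (hi : Integrable fun t => charFn h t - ((Real.exp (-‖t‖ ^ 2 / 2) : ℝ) : ℂ)) {C : ℝ}
    (hC : ∫ t, ‖charFn h t - ((Real.exp (-‖t‖ ^ 2 / 2) : ℝ) : ℂ)‖ ≤ C) :
    MemLp h ∞ volume ∧
      eLpNorm (fun x => h x - gaussian d x) ∞ volume ≤ ENNReal.ofReal C := by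
  have hG := integrable_gaussian (d := d)
  have hφ : charFn (fun x => h x - gaussian d x) =
      fun t => charFn h t - ((Real.exp (-‖t‖ ^ 2 / 2) : ℝ) : ℂ) := by
    ext t
    rw [charFn_sub hh hG, charFn_gaussian]
  have hae := ae_abs_le_integral_norm_charFn (hh.sub hG) (h := fun x => h x - gaussian d x)
    (by rw [hφ]; exact hi)
  have hae' : ∀ᵐ x, ‖h x - gaussian d x‖ ≤ C := by
    filter_upwards [hae] with x hx
    rw [hφ] at hx
    exact hx.trans hC
  constructor
  · refine memLp_top_of_bound hh.aestronglyMeasurable (C + (2 * Real.pi) ^ (-((d : ℝ) / 2))) ?_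
    filter_upwards [hae'] with x hx
    have h1 : ‖gaussian d x‖ ≤ (2 * Real.pi) ^ (-((d : ℝ) / 2)) := by
      rw [Real.norm_of_nonneg (gaussian_nonneg x)]
      refine mul_le_of_le_one_right (by positivity) (Real.exp_le_one_iff.2 ?_)
      have := sq_nonneg ‖x‖
      linarith
    calc ‖h x‖ = ‖(h x - gaussian d x) + gaussian d x‖ := by congr 1; ring
      _ ≤ _ := (norm_add_le _ _).trans (add_le_add hx h1)
  · rw [eLpNorm_exponent_top]
    exact eLpNormEssSup_le_of_ae_bound hae'

end BerryEsseen

open BerryEsseen in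
theorem theorem3p6 (p : ℝ≥0∞) (hp_one : 1 < p) (hp_top : p < ∞) :
    ∃ N : ℕ, 1 ≤ N ∧
      ∀ (d : ℕ), 1 ≤ d → ∀ (Λ ρ : ℝ) (M : ℝ≥0),
        ∃ C : ℝ, 0 < C ∧
          ∀ (s : ℝ), 0 < s → s ≤ 1 →
          ∀ (f : EuclideanSpace ℝ (Fin d) → ℝ),
            BerryEsseen.IsNormalisedDensity f s ρ →
            MemLp f p volume → eLpNorm f p volume = (M : ℝ≥0∞) →
          ∀ (σ : ℕ → ℝ), (∀ i, 1 ≤ i → 0 < σ i) →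
          ∀ (l L : ℝ), 0 < l → L / l = Λ →
          ∀ (n : ℕ), N ≤ n → (∀ i, 1 ≤ i → i ≤ n → l ≤ σ i ∧ σ i ≤ L) →
            MemLp (BerryEsseen.normalisedDensity f σ n) ∞ volume ∧
            eLpNorm (fun x => BerryEsseen.normalisedDensity f σ n x - BerryEsseen.gaussian d x)
              ∞ volume ≤ ENNReal.ofReal (C / (n : ℝ) ^ (s / 2)) := by
  have hq : 0 < p.toReal - 1 := by
    rw [sub_pos, ← ENNReal.toReal_one]
    exact (ENNReal.toReal_lt_toReal ENNReal.one_ne_top hp_top.ne).2 hp_one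
  -- The exponent of integrability from the layer-cake estimate with `q = p - 1`; it involves
  -- neither `d` nor `f`.
  obtain ⟨N, hN⟩ := exists_nat_ge (3 + 1 / (p.toReal - 1))
  have hN1 : 1 ≤ N := by
    have h1 : 0 < 1 / (p.toReal - 1) := by positivity
    have h2 : (1 : ℝ) ≤ N := by linarith
    exact_mod_cast h2
  refine ⟨N, hN1, fun d _ Λ ρ M => ?_⟩
  -- The `+ 1` keeps `K` positive even for `M = 0`.
  set K : ℝ := (M : ℝ) ^ p.toReal + 1 with hKdef
  have hK : 0 < K := by positivity
  obtain ⟨c, hc0, hc, hexp⟩ := exists_norm_charFn_le_exp d hK hq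
  -- `C` is chosen before `f` and `σ`, when nothing is known about the signs of `ρ` and `Λ`; hence
  -- `|ρ|` and `max Λ 1`.
  obtain ⟨C, hC, hmain⟩ := exists_integral_norm_prod_sub_exp_le d hN1 hc0 hc
    (D := 4 * |ρ| + 1) (Λ := max Λ 1)
    (B := N * (4 * (2 * Real.pi) ^ d * (2 * K) ^ (1 / (p.toReal - 1))))
    (by positivity) (le_max_right _ _) (by positivity)
  refine ⟨C, hC, fun s hs0 hs1 f hf hfp hfM σ hσ l L hl hLl n hn hlL => ?_⟩
  have hn1 : 1 ≤ n := hN1.trans hn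
  have hn0 : (0 : ℝ) < n := by exact_mod_cast hn1
  have hsn : 0 < Real.sqrt n := Real.sqrt_pos.2 hn0
  have hl' : ∀ i ∈ Finset.Icc 1 n, l ≤ σ i := fun i hi =>
    (hlL i (Finset.mem_Icc.1 hi).1 (Finset.mem_Icc.1 hi).2).1
  have hL' : ∀ i ∈ Finset.Icc 1 n, σ i ≤ L := fun i hi =>
    (hlL i (Finset.mem_Icc.1 hi).1 (Finset.mem_Icc.1 hi).2).2
  have hL : 0 < L := (hσ 1 le_rfl).trans_le (hL' 1 (Finset.mem_Icc.2 ⟨le_rfl, hn1⟩))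
  have hΛ : 0 < Λ := hLl ▸ div_pos hL hl
  have htail : HasTailBound f K (p.toReal - 1) := fun lam hlam =>
    (hasTailBound_of_eLpNorm_eq hf.nonneg hp_one hp_top hfp hfM lam hlam).trans (by
      gcongr
      exact le_add_of_nonneg_right zero_le_one)
  set b := Real.sqrt n * quadMean σ n with hb
  have hb0 : 0 < b := sqrt_mul_quadMean_pos hn1 hσ
  have hbl := sqrt_mul_le_sqrt_mul_quadMean hn1 hσ hl hl'
  have hbL := sqrt_mul_quadMean_le_sqrt_mul hn1 hσ hL hL'
  rw [← hb] at hbl hbL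
  obtain ⟨hpow, hpowB⟩ := integrable_and_integral_norm_charFn_pow_le hf.integrable hf.nonneg
    hf.integral_eq_one hK hq htail hN
  obtain ⟨hi, hle⟩ := hmain (charFn f) (continuous_charFn hf.integrable)
    (hexp f hf.integrable hf.nonneg hf.integral_eq_one (hf.integrable_norm_sq hs0)
      (hf.integral_norm_sq hs0) htail) hpow hpowB s hs0 hs1
    (fun u hu => (hf.norm_charFn_sub_exp_le hs0 hs1 hu).trans (by
      gcongr
      exact le_abs_self ρ)) n (fun i => σ i / b) hn
    (fun i hi => by
      calc (max Λ 1 * Real.sqrt n)⁻¹ ≤ (Λ * Real.sqrt n)⁻¹ := by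
            gcongr
            exact le_max_left _ _
        _ = l / (Real.sqrt n * L) := by rw [← hLl]; field_simp
        _ ≤ σ i / b := div_le_div₀ (hσ i (Finset.mem_Icc.1 hi).1).le (hl' i hi) hb0 hbL)
    (fun i hi => by
      calc σ i / b ≤ L / (Real.sqrt n * l) := div_le_div₀ hL.le (hL' i hi) (by positivity) hbl
        _ = Λ / Real.sqrt n := by rw [← hLl]; field_simp
        _ ≤ _ := by
            gcongr
            exact le_max_left _ _)
    (by
      simp only [div_pow]
      rw [← Finset.sum_div, ← sqrt_mul_quadMean_sq hn1, ← hb, div_self (by positivity)])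
  have hφ : ∀ t, charFn (normalisedDensity f σ n) t =
      ∏ i ∈ Finset.Icc 1 n, charFn f ((σ i / b) • t) :=
    charFn_normalisedDensity hf.integrable hσ hn1
  simp only [← hφ] at hi hle
  exact memLp_top_and_eLpNorm_sub_gaussian_le (integrable_normalisedDensity hf.integrable hσ hn1)
    hi hle
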